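/- Let $d\ge 0$. A pure $d$-dimensional orthogonal polytope is a finite union $P\subset\mathbb{R}^d$ of axis-aligned boxes $\prod_{i=1}^d[a_i,b_i]$ with $a_i<b_i$ for all $i$. The tangent cone of $P$ at $v\in P$ is the union $\alpha(v)$ of closed orthants such that, for some $\delta>0$, $P\cap(v+[-\delta,\delta]^d)=v+(\alpha(v)\cap[-\delta,\delta]^d)$. The genericity region of $v$ is the set of points that can be joined to $v$ by a path in $P$ along which every tangent cone is congruent to $\alpha(v)$ under the group of signed coordinate permutations; $v$ is a vertex (singular point) of $P$ if its genericity region lies in a $0$-dimensional coordinate-parallel affine subspace, that is, if it is $\{v\}$. A series-parallel diagram is a single edge or a series or parallel connection of two series-parallel diagrams; the one-vertex diagram without edges is also admitted (it is needed only for $d=0$, and describes all of $\mathbb{R}^0$). Given a diagram $\Delta$ whose edges are labelled bijectively by $\{1,\dots,d\}$ and signs $s\in\{\pm1\}^d$, the floral vertex determined by $(\Delta,s)$ is the subset of $\mathbb{R}^d$ obtained by reading series connection as intersection, parallel connection as union and the edge $i$ as the half-space $\{x: s_ix_i\ge 0\}$. The bouquet sign of $\Delta$ is $\sigma(\Delta)=(-1)^{e-v+1}$,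 where $e$ and $v$ are its numbers of edges and vertices. The set $P$ is a generic orthotope of dimension $d$ if it is a pure $d$-dimensional orthogonal polytope and $\alpha(v)$ is a floral vertex, determined by some $(\Delta,s)$, for each vertex $v$ of $P$. The (combinatorial) Euler characteristic $\chi(P)$ is the alternating sum $\sum_{B}(-1)^{\dim B}$ over the cells $B$ of a subdivision of $P$ into a finite polyhedral complex of axis-aligned boxes. Theorem. Let $P\subset\mathbb{R}^d$ be a generic orthotope. Then $P$ has finitely many vertices; for each vertex $v$ the number $\sigma(\alpha(v)):=\sigma(\Delta)$ does not depend on the choice of a signed diagram $(\Delta,s)$ that determines $\alpha(v)$; the set $P$ has a subdivision as above, and the value $\chi(P)$ is the same for all such subdivisions; and $$\chi(P)=2^{-d}\sigma(P),\qquad\text{where}\qquad \sigma(P)=\sum_{v\text{ vertex of }P}\sigma(\alpha(v)).$$ In particular, for $d=3$, if $n_i$ is the number of vertices of $P$ whose tangent cone consists of exactly $i$ octants, then $$n_1-n_3-n_5+n_7=8\,\chi(P).$$ -/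

import Mathlib

namespace Orthotope

/-! ### Axis-aligned boxes, orthogonal polytopes and box complexes -/

/-- An axis-aligned box `∏ [lo i, hi i]` in `ℝ^d`, where `lo i = hi i` is allowed. -/
@[ext]
structure AxisBox (d : ℕ) where
  lo : Fin d → ℝ
  hi : Fin d → ℝ
  le : ∀ i, lo i ≤ hi i

/-- The set of points of a box. -/
def AxisBox.carrier {d : ℕ} (B : AxisBox d) : Set (Fin d → ℝ) :=
  {x | ∀ i, B.lo i ≤ x i ∧ x i ≤ B.hi i}

/-- The dimension of a box: the number of its nondegenerate sides. -/
noncomputable def AxisBox.dim {d : ℕ} (B : AxisBox d) : ℕ :=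
  Set.ncard {i : Fin d | B.lo i < B.hi i}

/-- `F` is a (nonempty) face of `B`: each side of `F` is a side of `B` or one of its end points. -/
def AxisBox.IsFace {d : ℕ} (F B : AxisBox d) : Prop :=
  ∀ i, (F.lo i = B.lo i ∧ F.hi i = B.hi i) ∨
    (F.lo i = B.lo i ∧ F.hi i = B.lo i) ∨
    (F.lo i = B.hi i ∧ F.hi i = B.hi i)

/-- `P` is a pure `d`-dimensional orthogonal polytope in `ℝ^d`: a union of finitely many
axis-aligned boxes all of whose sides are nondegenerate. -/
def IsPureOrthogonalPolytope {d : ℕ} (P : Set (Fin d → ℝ)) : Prop :=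
  ∃ 𝓑 : Finset (AxisBox d), (∀ B ∈ 𝓑, ∀ i, B.lo i < B.hi i) ∧ P = ⋃ B ∈ 𝓑, B.carrier

/-- A finite polyhedral complex in `ℝ^d` all of whose cells are axis-aligned boxes. -/
structure BoxComplex (d : ℕ) where
  cells : Finset (AxisBox d)
  face_mem : ∀ B ∈ cells, ∀ F : AxisBox d, F.IsFace B → F ∈ cells
  inter_face : ∀ B ∈ cells, ∀ C ∈ cells, (B.carrier ∩ C.carrier).Nonempty →
    ∃ F : AxisBox d, F.IsFace B ∧ F.IsFace C ∧ F.carrier = B.carrier ∩ C.carrier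

/-- The underlying set of a box complex. -/
def BoxComplex.support {d : ℕ} (K : BoxComplex d) : Set (Fin d → ℝ) :=
  ⋃ B ∈ K.cells, B.carrier

/-- The alternating sum of the numbers of cells of each dimension. -/
noncomputable def BoxComplex.eulerChar {d : ℕ} (K : BoxComplex d) : ℤ :=
  ∑ B ∈ K.cells, (-1) ^ B.dim

/-- `χ` is the (combinatorial) Euler characteristic of `P`: the set `P` can be subdivided into a
box complex, and each such subdivision has alternating cell count `χ`. -/
def HasEulerChar {d : ℕ} (P : Set (Fin d → ℝ)) (χ : ℤ) : Prop :=
  (∃ K : BoxComplex d, K.support = P) ∧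
    ∀ K : BoxComplex d, K.support = P → K.eulerChar = χ

/-! ### Tangent cones and vertices -/

/-- The closed orthant represented by a sign vector. -/
def orthant {d : ℕ} (s : Fin d → ℤˣ) : Set (Fin d → ℝ) :=
  {x | ∀ i, 0 ≤ ((s i : ℤ) : ℝ) * x i}

/-- A local orthotopal arrangement: a union of orthants. -/
def IsLocalArrangement {d : ℕ} (α : Set (Fin d → ℝ)) : Prop :=
  ∃ S : Set (Fin d → ℤˣ), α = ⋃ s ∈ S, orthant s

/-- `α` is the tangent cone of `P` at `v`: a union of orthants that coincides with `P - v` on a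
cube `[-δ, δ]^d`. -/
def IsTangentCone {d : ℕ} (P : Set (Fin d → ℝ)) (v : Fin d → ℝ) (α : Set (Fin d → ℝ)) : Prop :=
  IsLocalArrangement α ∧
    ∃ δ : ℝ, 0 < δ ∧ ∀ x : Fin d → ℝ, (∀ i, |x i| ≤ δ) → (v + x ∈ P ↔ x ∈ α)

/-- Congruence under the symmetry group of the cube `[-1, 1]^d` (the signed permutations). -/
def Congruent {d : ℕ} (α β : Set (Fin d → ℝ)) : Prop :=
  ∃ (f : Equiv.Perm (Fin d)) (s : Fin d → ℤˣ),
    β = (fun (x : Fin d → ℝ) (i : Fin d) => ((s i : ℤ) : ℝ) * x (f i)) '' α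

/-- The genericity region of `v`: the points that can be joined to `v` by a path in `P` along
which the tangent cone is everywhere congruent to the tangent cone at `v`. -/
def genericityRegion {d : ℕ} (P : Set (Fin d → ℝ)) (v : Fin d → ℝ) : Set (Fin d → ℝ) :=
  {w | ∃ (γ : Path v w) (α : Set (Fin d → ℝ)), IsTangentCone P v α ∧
    ∀ t, γ t ∈ P ∧ ∃ β, IsTangentCone P (γ t) β ∧ Congruent α β}

/-- The generalized hyperplane given by the equations `x i = c i` for `i ∈ I`. -/
def generalizedHyperplane {d : ℕ} (I : Finset (Fin d)) (c : Fin d → ℝ) : Set (Fin d → ℝ) :=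
  {x | ∀ i ∈ I, x i = c i}

/-- The degree of genericity: the smallest dimension of a generalized hyperplane that contains
the genericity region. -/
noncomputable def genericityDegree {d : ℕ} (P : Set (Fin d → ℝ)) (v : Fin d → ℝ) : ℕ :=
  sInf {k | ∃ (I : Finset (Fin d)) (c : Fin d → ℝ),
    genericityRegion P v ⊆ generalizedHyperplane I c ∧ d - I.card = k}

/-- The vertices (singular points) of `P`: the points of `P` whose degree of genericity is `0`. -/
def vertices {d : ℕ} (P : Set (Fin d → ℝ)) : Set (Fin d → ℝ) :=
  {v | v ∈ P ∧ genericityDegree P v = 0}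

/-! ### Series-parallel diagrams -/

/-- Series-parallel diagrams with two distinct terminals and with edges labelled by `ι`. -/
inductive SPTree (ι : Type) : Type
  | edge (i : ι) : SPTree ι
  | series (Δ₁ Δ₂ : SPTree ι) : SPTree ι
  | parallel (Δ₁ Δ₂ : SPTree ι) : SPTree ι

/-- Series-parallel diagrams, including the honorary diagram that is a single vertex. -/
inductive SPD (ι : Type) : Type
  | point : SPD ι
  | tree (Δ : SPTree ι) : SPD ι

/-- The labels of the edges, with multiplicity. -/
def SPTree.edges {ι : Type} : SPTree ι → Multiset ι
  | .edge i => {i}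
  | .series Δ₁ Δ₂ => Δ₁.edges + Δ₂.edges
  | .parallel Δ₁ Δ₂ => Δ₁.edges + Δ₂.edges

/-- The number of vertices: a series connection identifies one pair of terminals, a parallel
connection identifies two. -/
def SPTree.numVertices {ι : Type} : SPTree ι → ℤ
  | .edge _ => 2
  | .series Δ₁ Δ₂ => Δ₁.numVertices + Δ₂.numVertices - 1
  | .parallel Δ₁ Δ₂ => Δ₁.numVertices + Δ₂.numVertices - 2

/-- The subset of `ℝ^d` obtained by reading series connection as intersection, parallel
connection as union, and the edge `i` as the half-space `{x | 0 ≤ s i * x i}`. -/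
def SPTree.arrangement {d : ℕ} (s : Fin d → ℤˣ) : SPTree (Fin d) → Set (Fin d → ℝ)
  | .edge i => {x | 0 ≤ ((s i : ℤ) : ℝ) * x i}
  | .series Δ₁ Δ₂ => Δ₁.arrangement s ∩ Δ₂.arrangement s
  | .parallel Δ₁ Δ₂ => Δ₁.arrangement s ∪ Δ₂.arrangement s

/-- The labels of the edges, with multiplicity. -/
def SPD.edges {ι : Type} : SPD ι → Multiset ι
  | .point => 0
  | .tree Δ => Δ.edges

/-- The number of vertices of a diagram. -/
def SPD.numVertices {ι : Type} : SPD ι → ℤ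
  | .point => 1
  | .tree Δ => Δ.numVertices

/-- The arrangement determined by a signed diagram; the honorary diagram is the empty
intersection. -/
def SPD.arrangement {d : ℕ} (s : Fin d → ℤˣ) : SPD (Fin d) → Set (Fin d → ℝ)
  | .point => Set.univ
  | .tree Δ => Δ.arrangement s

/-- The bouquet rank `e - v + 1`, that is, the number of independent loops. -/
def SPD.bouquetRank {ι : Type} (Δ : SPD ι) : ℤ :=
  (Multiset.card Δ.edges : ℤ) - Δ.numVertices + 1

/-- The bouquet sign `(-1) ^ (e - v + 1)`. -/
def SPD.bouquetSign {ι : Type} (Δ : SPD ι) : ℤ :=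
  ((Int.negOnePow Δ.bouquetRank : ℤˣ) : ℤ)

/-! ### Generic orthotopes -/

/-- The tangent cone of `P` at `v` is the floral vertex determined by the signed diagram `(Δ, s)`,
in which each of the `d` coordinates labels exactly one edge. -/
def IsFloralAt {d : ℕ} (P : Set (Fin d → ℝ)) (v : Fin d → ℝ)
    (Δ : SPD (Fin d)) (s : Fin d → ℤˣ) : Prop :=
  Δ.edges = (Finset.univ : Finset (Fin d)).val ∧ IsTangentCone P v (Δ.arrangement s)

/-- A generic orthotope of dimension `d`: a pure `d`-dimensional orthogonal polytope in `ℝ^d` at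
each of whose vertices the tangent cone is a floral vertex on `d` half-spaces. -/
def IsGenericOrthotope {d : ℕ} (P : Set (Fin d → ℝ)) : Prop :=
  IsPureOrthogonalPolytope P ∧
    ∀ v ∈ vertices P, ∃ (Δ : SPD (Fin d)) (s : Fin d → ℤˣ), IsFloralAt P v Δ s

open Classical in
/-- The bouquet sign of a diagram that describes the tangent cone of `P` at `v`. -/
noncomputable def vertexSign {d : ℕ} (P : Set (Fin d → ℝ)) (v : Fin d → ℝ) : ℤ :=
  if h : ∃ Δ : SPD (Fin d), ∃ s : Fin d → ℤˣ, IsFloralAt P v Δ s then h.choose.bouquetSign else 0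

/-- The sum `σ(P)` of the bouquet signs of all vertices. -/
noncomputable def sigma {d : ℕ} (P : Set (Fin d → ℝ)) : ℤ :=
  ∑ᶠ v ∈ vertices P, vertexSign P v

/-- The number of vertices of `P` whose tangent cone occupies exactly `k` orthants. -/
noncomputable def vertexCount {d : ℕ} (P : Set (Fin d → ℝ)) (k : ℕ) : ℕ :=
  Set.ncard {v | v ∈ vertices P ∧
    ∃ α, IsTangentCone P v α ∧ Set.ncard {s : Fin d → ℤˣ | orthant s ⊆ α} = k}

end Orthotope

/-!
The Euler characteristic of a box complex can be localized at the corners of its cells: a cell `B`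
has `2 ^ dim B` corners, so `2 ^ d * χ` is the sum over all corners `v` of the numbers
`∑ (-1) ^ dim B * 2 ^ (d - dim B)`, where `B` runs over the cells with corner `v`. These cells
correspond to the faces, cut out by the coordinate hyperplanes, of the tangent cone at `v`. Hence
the local number is `cornerWeight α`, which depends on the tangent cone `α` only
(`BoxComplex.two_pow_mul_eulerChar`).

The corner weight is the measure of `α` under a signed product measure on sign vectors, whose factor
gives mass `2` to `0` and mass `-1` to each of `1` and `-1`. The total mass of the factor is `0`, so
cylinders in a coordinate direction have corner weight `0`, while half-lines have mass `1`.
Therefore a series connection multiplies corner weights, and in a parallel connection only the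
intersection term of the inclusion-exclusion formula survives: the corner weight of a floral vertex
is its bouquet sign (`cornerWeight_arrangement`). In particular the sign depends on the cone alone.

A point of `P` is a vertex exactly if its tangent cone is a cylinder in no coordinate direction
(`IsTangentCone.notMem_vertices`, `IsTangentCone.exists_independentOf`): one can move along a
cylinder without changing the tangent cone, and conversely the tangent cone at a point close to `v`
is a cylinder in each direction in which the point differs from `v`. So the corners that are not
vertices contribute `0`, and every vertex is a corner of every subdivision
(`BoxComplex.vertices_subset_corners`). This gives `2 ^ d * χ = σ(P)` for each subdivision at once
(`IsGenericOrthotope.two_pow_mul_eulerChar`); a subdivision is obtained from the grid spanned by the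
coordinates of finitely many boxes that cover `P`.

The count in dimension `3` evaluates the diagrams with three edges under the product measure above
and under the counting measure on orthants, whose factors have total mass `2`
(`SPTree.mass_of_card_eq_three`).
-/

namespace Orthotope

/-! ### Weighted sums over finite product spaces -/

/-- The sum of `g` over `E ^ d` against the product of the weights `u i`. -/
def weightedSum {d : ℕ} {E : Type} [Fintype E] (u : Fin d → E → ℤ) (g : (Fin d → E) → ℤ) : ℤ :=
  ∑ e, (∏ i, u i (e i)) * g e

/-- The weights `u` with those of the coordinates in `S` replaced by the unit mass at `a`. -/
def concentrate {d : ℕ} {E : Type} [DecidableEq E] (a : E) (S : Multiset (Fin d))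
    (u : Fin d → E → ℤ) : Fin d → E → ℤ :=
  fun i => if i ∈ S then Pi.single a 1 else u i

/-- Fubini's theorem for a single coordinate. -/
lemma weightedSum_mul_of_invariant {d : ℕ} {E : Type} [Fintype E] [DecidableEq E] (a : E)
    (i : Fin d) (u : Fin d → E → ℤ) (k : E → ℤ)
    (g : (Fin d → E) → ℤ) (hg : ∀ e x, g (Function.update e i x) = g e) :
    weightedSum u (fun e => k (e i) * g e) =
      (∑ x, u i x * k x) * weightedSum (concentrate a {i} u) g := by
  have hsplit : ∀ f : (Fin d → E) → ℤ, ∑ e, f e =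
      ∑ x : E, ∑ r : ({j // j ≠ i} → E), f ((Equiv.funSplitAt i E).symm (x, r)) := by
    intro f
    rw [← Fintype.sum_prod_type' (f := fun x r => f ((Equiv.funSplitAt i E).symm (x, r)))]
    exact ((Equiv.funSplitAt i E).symm.sum_comp f).symm
  have hx : ∀ (x : E) (r : {j // j ≠ i} → E), (Equiv.funSplitAt i E).symm (x, r) i = x := by
    intro x r
    simp [Equiv.funSplitAt, Equiv.piSplitAt]
  have hr : ∀ (x : E) (r : {j // j ≠ i} → E) (j : {j // j ≠ i}),
      (Equiv.funSplitAt i E).symm (x, r) j = r j := by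
    intro x r j
    simp [Equiv.funSplitAt, Equiv.piSplitAt, j.2]
  have hgr : ∀ (x : E) (r : {j // j ≠ i} → E),
      g ((Equiv.funSplitAt i E).symm (x, r)) = g ((Equiv.funSplitAt i E).symm (a, r)) := by
    intro x r
    rw [← hg ((Equiv.funSplitAt i E).symm (x, r)) a]
    congr 1
    funext j
    by_cases hj : j = i
    · subst hj
      simp [hx]
    · rw [Function.update_of_ne hj, hr x r ⟨j, hj⟩, hr a r ⟨j, hj⟩]
  have hu : ∀ j : {j // j ≠ i}, concentrate a {i} u j = u j := by
    intro j
    simp [concentrate, j.2]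
  have hui : concentrate a {i} u i = Pi.single a 1 := by
    simp [concentrate]
  unfold weightedSum
  rw [hsplit, hsplit]
  simp only [Fintype.prod_eq_mul_prod_subtype_ne _ i, hx, hr, hgr, hu, hui]
  have hfactor : ∀ c : E → ℤ, ∑ x, ∑ r : ({j // j ≠ i} → E),
      (c x * ∏ j : {j // j ≠ i}, u j (r j)) * g ((Equiv.funSplitAt i E).symm (a, r)) =
      (∑ x, c x) * ∑ r : ({j // j ≠ i} → E),
        (∏ j : {j // j ≠ i}, u j (r j)) * g ((Equiv.funSplitAt i E).symm (a, r)) := by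
    intro c
    rw [Finset.sum_mul]
    refine Finset.sum_congr rfl fun x _ => ?_
    rw [Finset.mul_sum]
    exact Finset.sum_congr rfl fun r _ => by ring
  rw [hfactor (Pi.single a 1), Finset.sum_pi_single', if_pos (Finset.mem_univ a), one_mul,
    ← hfactor]
  exact Finset.sum_congr rfl fun x _ => Finset.sum_congr rfl fun r _ => by ring

lemma concentrate_concentrate {d : ℕ} {E : Type} [DecidableEq E] (a : E)
    (S T : Multiset (Fin d)) (u : Fin d → E → ℤ) :
    concentrate a S (concentrate a T u) = concentrate a (T + S) u := by
  funext i
  by_cases h₁ : i ∈ S <;> by_cases h₂ : i ∈ T <;> simp [concentrate, h₁, h₂]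

/-- Summing out coordinates on which the summand does not depend. -/
lemma weightedSum_of_invariant {d : ℕ} {E : Type} [Fintype E] [DecidableEq E] (a : E) (Z : ℤ)
    (S : Multiset (Fin d)) (hS : S.Nodup) :
    ∀ (u : Fin d → E → ℤ), (∀ i ∈ S, ∑ x, u i x = Z) → ∀ (g : (Fin d → E) → ℤ),
      (∀ i ∈ S, ∀ e x, g (Function.update e i x) = g e) →
      weightedSum u g = Z ^ Multiset.card S * weightedSum (concentrate a S u) g := by
  induction S using Multiset.induction_on with
  | empty =>
    intro u _ g _
    simp only [Multiset.card_zero, pow_zero, one_mul]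
    congr 1
  | cons i S ih =>
    intro u hu g hg
    rw [Multiset.nodup_cons] at hS
    have h := weightedSum_mul_of_invariant a i u (fun _ => 1) g (hg i (by simp))
    simp only [one_mul, mul_one] at h
    rw [h, hu i (by simp), ih hS.2 _ ?_ g ?_, concentrate_concentrate, Multiset.card_cons,
      pow_succ, Multiset.singleton_add]
    · ring
    · intro j hj
      have hji : j ≠ i := fun h => hS.1 (h ▸ hj)
      rw [← hu j (by simp [hj])]
      simp [concentrate, hji]
    · intro j hj
      exact hg j (by simp [hj])

/-! ### Valuations of series-parallel diagrams -/

/-- The indicator function of a diagram, where `p i` is the indicator function of the edge `i`. -/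
def SPTree.indicator {ι E : Type} (p : ι → E → ℤ) : SPTree ι → (ι → E) → ℤ
  | .edge i, e => p i (e i)
  | .series Δ₁ Δ₂, e => Δ₁.indicator p e * Δ₂.indicator p e
  | .parallel Δ₁ Δ₂, e =>
      Δ₁.indicator p e + Δ₂.indicator p e - Δ₁.indicator p e * Δ₂.indicator p e

/-- The measure of the set described by a diagram with distinct labels, with respect to a product
measure that gives each half-space mass `1` and each factor total mass `Z`. -/
def SPTree.mass {ι : Type} (Z : ℤ) : SPTree ι → ℤ
  | .edge _ => 1
  | .series Δ₁ Δ₂ => Δ₁.mass Z * Δ₂.mass Z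
  | .parallel Δ₁ Δ₂ => Δ₁.mass Z * Z ^ Multiset.card Δ₂.edges +
      Δ₂.mass Z * Z ^ Multiset.card Δ₁.edges - Δ₁.mass Z * Δ₂.mass Z

lemma SPTree.indicator_update {ι E : Type} [DecidableEq ι] (p : ι → E → ℤ) (Δ : SPTree ι) (i : ι)
    (hi : i ∉ Δ.edges) (e : ι → E) (x : E) :
    Δ.indicator p (Function.update e i x) = Δ.indicator p e := by
  induction Δ with
  | edge j =>
    have hij : j ≠ i := by
      rintro rfl
      simp [SPTree.edges] at hi
    simp [SPTree.indicator, hij]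
  | series Δ₁ Δ₂ h₁ h₂ =>
    simp only [SPTree.edges, Multiset.mem_add, not_or] at hi
    simp [SPTree.indicator, h₁ hi.1, h₂ hi.2]
  | parallel Δ₁ Δ₂ h₁ h₂ =>
    simp only [SPTree.edges, Multiset.mem_add, not_or] at hi
    simp [SPTree.indicator, h₁ hi.1, h₂ hi.2]

lemma concentrate_of_disjoint {d : ℕ} {E : Type} [DecidableEq E] (a : E) {S T : Multiset (Fin d)}
    (h : Disjoint S T) (u : Fin d → E → ℤ) {i : Fin d} (hi : i ∈ T) :
    concentrate a S u i = u i := by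
  have : i ∉ S := fun hS => Multiset.disjoint_left.mp h hS hi
  simp [concentrate, this]

lemma weightedSum_add {d : ℕ} {E : Type} [Fintype E] (u : Fin d → E → ℤ)
    (f g : (Fin d → E) → ℤ) :
    weightedSum u (fun e => f e + g e) = weightedSum u f + weightedSum u g := by
  simp [weightedSum, mul_add, Finset.sum_add_distrib]

lemma weightedSum_sub {d : ℕ} {E : Type} [Fintype E] (u : Fin d → E → ℤ)
    (f g : (Fin d → E) → ℤ) :
    weightedSum u (fun e => f e - g e) = weightedSum u f - weightedSum u g := by
  simp [weightedSum, mul_sub, Finset.sum_sub_distrib]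

/-- The edges of a diagram can be summed out; they contribute the mass of the diagram. The factor
`g` stands for the part of a larger diagram that involves other edges only. -/
lemma SPTree.weightedSum_indicator_mul {d : ℕ} {E : Type} [Fintype E] [DecidableEq E] (a : E)
    (Z : ℤ) (p : Fin d → E → ℤ) (Δ : SPTree (Fin d)) (hΔ : Δ.edges.Nodup) :
    ∀ (u : Fin d → E → ℤ), (∀ i ∈ Δ.edges, ∑ x, u i x = Z) →
      (∀ i ∈ Δ.edges, ∑ x, u i x * p i x = 1) → ∀ (g : (Fin d → E) → ℤ),
      (∀ i ∈ Δ.edges, ∀ e x, g (Function.update e i x) = g e) →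
      weightedSum u (fun e => Δ.indicator p e * g e) =
        Δ.mass Z * weightedSum (concentrate a Δ.edges u) g := by
  -- the intersection of two diagrams on disjoint sets of edges
  have hinter : ∀ Δ₁ Δ₂ : SPTree (Fin d), (Δ₁.edges + Δ₂.edges).Nodup →
      (∀ (u : Fin d → E → ℤ), (∀ i ∈ Δ₁.edges, ∑ x, u i x = Z) →
        (∀ i ∈ Δ₁.edges, ∑ x, u i x * p i x = 1) → ∀ (g : (Fin d → E) → ℤ),
        (∀ i ∈ Δ₁.edges, ∀ e x, g (Function.update e i x) = g e) →
        weightedSum u (fun e => Δ₁.indicator p e * g e) =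
          Δ₁.mass Z * weightedSum (concentrate a Δ₁.edges u) g) →
      (∀ (u : Fin d → E → ℤ), (∀ i ∈ Δ₂.edges, ∑ x, u i x = Z) →
        (∀ i ∈ Δ₂.edges, ∑ x, u i x * p i x = 1) → ∀ (g : (Fin d → E) → ℤ),
        (∀ i ∈ Δ₂.edges, ∀ e x, g (Function.update e i x) = g e) →
        weightedSum u (fun e => Δ₂.indicator p e * g e) =
          Δ₂.mass Z * weightedSum (concentrate a Δ₂.edges u) g) →
      ∀ (u : Fin d → E → ℤ), (∀ i ∈ Δ₁.edges + Δ₂.edges, ∑ x, u i x = Z) →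
        (∀ i ∈ Δ₁.edges + Δ₂.edges, ∑ x, u i x * p i x = 1) → ∀ (g : (Fin d → E) → ℤ),
        (∀ i ∈ Δ₁.edges + Δ₂.edges, ∀ e x, g (Function.update e i x) = g e) →
        weightedSum u (fun e => Δ₁.indicator p e * (Δ₂.indicator p e * g e)) =
          Δ₁.mass Z * Δ₂.mass Z * weightedSum (concentrate a (Δ₁.edges + Δ₂.edges) u) g := by
    intro Δ₁ Δ₂ hnd h₁ h₂ u hu hp g hg
    obtain ⟨_, _, hdis⟩ := Multiset.nodup_add.mp hnd
    rw [h₁ u (fun i hi => hu i (by simp [hi])) (fun i hi => hp i (by simp [hi])) _ ?_,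
      h₂ _ ?_ ?_ g (fun i hi => hg i (by simp [hi])), concentrate_concentrate, mul_assoc]
    · intro i hi
      rw [concentrate_of_disjoint a hdis u hi]
      exact hu i (by simp [hi])
    · intro i hi
      rw [concentrate_of_disjoint a hdis u hi]
      exact hp i (by simp [hi])
    · intro i hi e x
      rw [hg i (by simp [hi]), Δ₂.indicator_update p i (Multiset.disjoint_left.mp hdis hi)]
  -- a diagram that involves only some of the edges that are summed out
  have hcyl : ∀ (Δ₁ : SPTree (Fin d)) (T : Multiset (Fin d)), (Δ₁.edges + T).Nodup →
      (∀ (u : Fin d → E → ℤ), (∀ i ∈ Δ₁.edges, ∑ x, u i x = Z) →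
        (∀ i ∈ Δ₁.edges, ∑ x, u i x * p i x = 1) → ∀ (g : (Fin d → E) → ℤ),
        (∀ i ∈ Δ₁.edges, ∀ e x, g (Function.update e i x) = g e) →
        weightedSum u (fun e => Δ₁.indicator p e * g e) =
          Δ₁.mass Z * weightedSum (concentrate a Δ₁.edges u) g) →
      ∀ (u : Fin d → E → ℤ), (∀ i ∈ Δ₁.edges + T, ∑ x, u i x = Z) →
        (∀ i ∈ Δ₁.edges + T, ∑ x, u i x * p i x = 1) → ∀ (g : (Fin d → E) → ℤ),
        (∀ i ∈ Δ₁.edges + T, ∀ e x, g (Function.update e i x) = g e) →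
        weightedSum u (fun e => Δ₁.indicator p e * g e) =
          Δ₁.mass Z * Z ^ Multiset.card T * weightedSum (concentrate a (Δ₁.edges + T) u) g := by
    intro Δ₁ T hnd h₁ u hu hp g hg
    obtain ⟨_, hT, hdis⟩ := Multiset.nodup_add.mp hnd
    rw [h₁ u (fun i hi => hu i (by simp [hi])) (fun i hi => hp i (by simp [hi])) g
        (fun i hi => hg i (by simp [hi])),
      weightedSum_of_invariant a Z T hT _ ?_ g (fun i hi => hg i (by simp [hi])),
      concentrate_concentrate, mul_assoc]
    intro i hi
    rw [concentrate_of_disjoint a hdis u hi]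
    exact hu i (by simp [hi])
  induction Δ with
  | edge i =>
    intro u _ hp g hg
    have h := weightedSum_mul_of_invariant a i u (p i) g (hg i (by simp [SPTree.edges]))
    rw [hp i (by simp [SPTree.edges])] at h
    exact h
  | series Δ₁ Δ₂ h₁ h₂ =>
    intro u hu hp g hg
    obtain ⟨n₁, n₂, _⟩ := Multiset.nodup_add.mp hΔ
    simp only [SPTree.indicator, SPTree.mass, mul_assoc]
    rw [hinter Δ₁ Δ₂ hΔ (h₁ n₁) (h₂ n₂) u hu hp g hg, mul_assoc]
    rfl
  | parallel Δ₁ Δ₂ h₁ h₂ =>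
    intro u hu hp g hg
    obtain ⟨n₁, n₂, _⟩ := Multiset.nodup_add.mp hΔ
    have hcomm : Δ₂.edges + Δ₁.edges = Δ₁.edges + Δ₂.edges := add_comm _ _
    have c₂ := hcyl Δ₂ Δ₁.edges (hcomm ▸ hΔ) (h₂ n₂)
    rw [hcomm] at c₂
    simp only [SPTree.indicator, SPTree.mass, sub_mul, add_mul, mul_assoc (SPTree.indicator p _ _)]
    rw [weightedSum_sub, weightedSum_add, hinter Δ₁ Δ₂ hΔ (h₁ n₁) (h₂ n₂) u hu hp g hg,
      hcyl Δ₁ Δ₂.edges hΔ (h₁ n₁) u hu hp g hg, c₂ u hu hp g hg]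
    rfl

lemma SPTree.weightedSum_indicator {d : ℕ} {E : Type} [Fintype E] [DecidableEq E] (a : E) (Z : ℤ)
    (u p : Fin d → E → ℤ) (Δ : SPTree (Fin d))
    (hΔ : Δ.edges = (Finset.univ : Finset (Fin d)).val) (hu : ∀ i, ∑ x, u i x = Z)
    (hp : ∀ i, ∑ x, u i x * p i x = 1) : weightedSum u (Δ.indicator p) = Δ.mass Z := by
  have h := Δ.weightedSum_indicator_mul a Z p (hΔ ▸ Finset.univ.nodup) u (fun i _ => hu i)
    (fun i _ => hp i) (fun _ => 1) (fun _ _ _ _ => rfl)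
  have hone : weightedSum (concentrate a Δ.edges u) (fun _ => 1) = 1 := by
    have hc : concentrate a Δ.edges u = fun _ => Pi.single a 1 := by
      funext i
      simp [concentrate, hΔ]
    simp only [weightedSum, hc, mul_one]
    rw [Finset.sum_eq_single (fun _ => a)]
    · simp
    · intro e _ he
      obtain ⟨i, hi⟩ := Function.ne_iff.mp he
      exact Finset.prod_eq_zero (Finset.mem_univ i) (Pi.single_eq_of_ne hi _)
    · simp
  simpa [hone] using h

lemma SPTree.card_edges_pos {ι : Type} (Δ : SPTree ι) : 0 < Multiset.card Δ.edges := by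
  induction Δ with
  | edge i => simp [SPTree.edges]
  | series Δ₁ Δ₂ h₁ h₂ => simp only [SPTree.edges, Multiset.card_add]; omega
  | parallel Δ₁ Δ₂ h₁ h₂ => simp only [SPTree.edges, Multiset.card_add]; omega

lemma SPTree.bouquetSign_edge {ι : Type} (i : ι) : (SPD.tree (.edge i)).bouquetSign = 1 := by
  simp [SPD.bouquetSign, SPD.bouquetRank, SPD.edges, SPD.numVertices, SPTree.edges,
    SPTree.numVertices]

lemma SPTree.bouquetSign_series {ι : Type} (Δ₁ Δ₂ : SPTree ι) :
    (SPD.tree (.series Δ₁ Δ₂)).bouquetSign =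
      (SPD.tree Δ₁).bouquetSign * (SPD.tree Δ₂).bouquetSign := by
  rw [SPD.bouquetSign, SPD.bouquetSign, SPD.bouquetSign, ← Units.val_mul, ← Int.negOnePow_add]
  congr 2
  simp only [SPD.bouquetRank, SPD.edges, SPD.numVertices, SPTree.edges, SPTree.numVertices,
    Multiset.card_add]
  push_cast
  ring

lemma SPTree.bouquetSign_parallel {ι : Type} (Δ₁ Δ₂ : SPTree ι) :
    (SPD.tree (.parallel Δ₁ Δ₂)).bouquetSign =
      -((SPD.tree Δ₁).bouquetSign * (SPD.tree Δ₂).bouquetSign) := by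
  rw [SPD.bouquetSign, SPD.bouquetSign, SPD.bouquetSign, ← Units.val_mul, ← Int.negOnePow_add,
    ← Units.val_neg, ← Int.negOnePow_succ]
  congr 2
  simp only [SPD.bouquetRank, SPD.edges, SPD.numVertices, SPTree.edges, SPTree.numVertices,
    Multiset.card_add]
  push_cast
  ring

/-- With total mass `0` the cylinders drop out of the inclusion-exclusion for a parallel
connection, and each parallel connection changes the sign. -/
lemma SPTree.mass_zero {ι : Type} (Δ : SPTree ι) : Δ.mass 0 = (SPD.tree Δ).bouquetSign := by
  induction Δ with
  | edge i => rw [SPTree.bouquetSign_edge]; rfl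
  | series Δ₁ Δ₂ h₁ h₂ => rw [SPTree.bouquetSign_series, ← h₁, ← h₂]; rfl
  | parallel Δ₁ Δ₂ h₁ h₂ =>
    rw [SPTree.bouquetSign_parallel, ← h₁, ← h₂]
    simp [SPTree.mass, Δ₁.card_edges_pos.ne', Δ₂.card_edges_pos.ne']

lemma SPTree.mass_of_card_eq_one {ι : Type} (Δ : SPTree ι) (h : Multiset.card Δ.edges = 1) :
    ∀ Z, Δ.mass Z = 1 := by
  cases Δ with
  | edge i => intro Z; rfl
  | series Δ₁ Δ₂ =>
    have h₁ := Δ₁.card_edges_pos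
    have h₂ := Δ₂.card_edges_pos
    simp only [SPTree.edges, Multiset.card_add] at h
    omega
  | parallel Δ₁ Δ₂ =>
    have h₁ := Δ₁.card_edges_pos
    have h₂ := Δ₂.card_edges_pos
    simp only [SPTree.edges, Multiset.card_add] at h
    omega

lemma SPTree.mass_of_card_eq_two {ι : Type} (Δ : SPTree ι) (h : Multiset.card Δ.edges = 2) :
    (Δ.mass 0 = 1 ∧ Δ.mass 2 = 1) ∨ (Δ.mass 0 = -1 ∧ Δ.mass 2 = 3) := by
  cases Δ with
  | edge i => simp [SPTree.edges] at h
  | series Δ₁ Δ₂ =>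
    have h₁ := Δ₁.card_edges_pos
    have h₂ := Δ₂.card_edges_pos
    simp only [SPTree.edges, Multiset.card_add] at h
    have m₁ := Δ₁.mass_of_card_eq_one (by omega)
    have m₂ := Δ₂.mass_of_card_eq_one (by omega)
    simp [SPTree.mass, m₁, m₂]
  | parallel Δ₁ Δ₂ =>
    have h₁ := Δ₁.card_edges_pos
    have h₂ := Δ₂.card_edges_pos
    simp only [SPTree.edges, Multiset.card_add] at h
    have e₁ : Multiset.card Δ₁.edges = 1 := by omega
    have e₂ : Multiset.card Δ₂.edges = 1 := by omega
    have m₁ := Δ₁.mass_of_card_eq_one e₁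
    have m₂ := Δ₂.mass_of_card_eq_one e₂
    simp [SPTree.mass, m₁, m₂, e₁, e₂]

/-- The bouquet sign and the number of octants of a floral vertex in dimension `3`. -/
lemma SPTree.mass_of_card_eq_three {ι : Type} (Δ : SPTree ι) (h : Multiset.card Δ.edges = 3) :
    (Δ.mass 0 = 1 ∧ Δ.mass 2 = 1) ∨ (Δ.mass 0 = -1 ∧ Δ.mass 2 = 3) ∨
      (Δ.mass 0 = -1 ∧ Δ.mass 2 = 5) ∨ (Δ.mass 0 = 1 ∧ Δ.mass 2 = 7) := by
  cases Δ with
  | edge i => simp [SPTree.edges] at h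
  | series Δ₁ Δ₂ =>
    have h₁ := Δ₁.card_edges_pos
    have h₂ := Δ₂.card_edges_pos
    simp only [SPTree.edges, Multiset.card_add] at h
    rcases (by omega : Multiset.card Δ₁.edges = 1 ∧ Multiset.card Δ₂.edges = 2 ∨
      Multiset.card Δ₁.edges = 2 ∧ Multiset.card Δ₂.edges = 1) with ⟨e₁, e₂⟩ | ⟨e₁, e₂⟩
    · have m₁ := Δ₁.mass_of_card_eq_one e₁
      rcases Δ₂.mass_of_card_eq_two e₂ with ⟨a, b⟩ | ⟨a, b⟩ <;> simp [SPTree.mass, m₁, a, b]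
    · have m₂ := Δ₂.mass_of_card_eq_one e₂
      rcases Δ₁.mass_of_card_eq_two e₁ with ⟨a, b⟩ | ⟨a, b⟩ <;> simp [SPTree.mass, m₂, a, b]
  | parallel Δ₁ Δ₂ =>
    have h₁ := Δ₁.card_edges_pos
    have h₂ := Δ₂.card_edges_pos
    simp only [SPTree.edges, Multiset.card_add] at h
    rcases (by omega : Multiset.card Δ₁.edges = 1 ∧ Multiset.card Δ₂.edges = 2 ∨
      Multiset.card Δ₁.edges = 2 ∧ Multiset.card Δ₂.edges = 1) with ⟨e₁, e₂⟩ | ⟨e₁, e₂⟩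
    · have m₁ := Δ₁.mass_of_card_eq_one e₁
      rcases Δ₂.mass_of_card_eq_two e₂ with ⟨a, b⟩ | ⟨a, b⟩ <;>
        simp [SPTree.mass, m₁, a, b, e₁, e₂]
    · have m₂ := Δ₂.mass_of_card_eq_one e₂
      rcases Δ₁.mass_of_card_eq_two e₁ with ⟨a, b⟩ | ⟨a, b⟩ <;>
        simp [SPTree.mass, m₂, a, b, e₁, e₂]

open Classical in
lemma SPTree.indicator_eq_ite {d : ℕ} {E : Type} (c : E → ℝ) (s : Fin d → ℤˣ)
    (Δ : SPTree (Fin d)) (e : Fin d → E) :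
    Δ.indicator (fun i x => if 0 ≤ ((s i : ℤ) : ℝ) * c x then 1 else 0) e =
      if (fun i => c (e i)) ∈ Δ.arrangement s then 1 else 0 := by
  induction Δ with
  | edge i => rfl
  | series Δ₁ Δ₂ h₁ h₂ =>
    simp only [SPTree.indicator, SPTree.arrangement, h₁, h₂, Set.mem_inter_iff]
    split_ifs <;> simp_all
  | parallel Δ₁ Δ₂ h₁ h₂ =>
    simp only [SPTree.indicator, SPTree.arrangement, h₁, h₂, Set.mem_union]
    split_ifs <;> simp_all

/-! ### The corner weight of a cone -/

/-- The weight of a relatively open face of the arrangement of coordinate hyperplanes in a single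
coordinate; it adds up to `0`. -/
def faceWeight : SignType → ℤ
  | .zero => 2
  | .neg => -1
  | .pos => -1

open Classical in
/-- The corner weight `∑ (-1) ^ dim F * 2 ^ (d - dim F)` of a cone, where `F` runs over the faces
of the arrangement of coordinate hyperplanes that are contained in the cone. A face is represented
by the sign vector of its relative interior. -/
noncomputable def cornerWeight {d : ℕ} (α : Set (Fin d → ℝ)) : ℤ :=
  weightedSum (fun _ => faceWeight) fun e => if (fun i => ((e i : SignType) : ℝ)) ∈ α then 1 else 0

lemma sum_faceWeight : ∑ x, faceWeight x = 0 := by decide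

/-- The corner weight of a floral vertex is the bouquet sign. -/
theorem cornerWeight_arrangement {d : ℕ} (Δ : SPD (Fin d)) (s : Fin d → ℤˣ)
    (hΔ : Δ.edges = (Finset.univ : Finset (Fin d)).val) :
    cornerWeight (Δ.arrangement s) = Δ.bouquetSign := by
  classical
  cases Δ with
  | point =>
    have hd : d = 0 := by
      have := congrArg Multiset.card hΔ
      simpa [SPD.edges] using this.symm
    subst hd
    simp [cornerWeight, weightedSum, SPD.arrangement, SPD.bouquetSign, SPD.bouquetRank, SPD.edges,
      SPD.numVertices]
  | tree Δ =>
    rw [← SPTree.mass_zero, ← Δ.weightedSum_indicator 0 0 (fun _ => faceWeight)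
      (fun i x => if 0 ≤ ((s i : ℤ) : ℝ) * (x : ℝ) then 1 else 0) hΔ (fun _ => sum_faceWeight)]
    · rw [cornerWeight]
      congr 1
      funext e
      rw [SPTree.indicator_eq_ite (fun x : SignType => (x : ℝ))]
      rfl
    · intro i
      have huniv : (Finset.univ : Finset SignType) = {0, -1, 1} := rfl
      rcases Int.units_eq_one_or (s i) with h | h <;>
        simp [h, huniv, faceWeight] <;> norm_num

/-- A cone that does not depend on some coordinate has corner weight `0`. -/
lemma cornerWeight_eq_zero {d : ℕ} (α : Set (Fin d → ℝ)) (i : Fin d)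
    (h : ∀ x t, Function.update x i t ∈ α ↔ x ∈ α) : cornerWeight α = 0 := by
  classical
  rw [cornerWeight, weightedSum_of_invariant 0 0 {i} (by simp) _ (fun _ _ => sum_faceWeight)]
  · simp
  · intro j hj e x
    rw [Multiset.mem_singleton] at hj
    subst hj
    have : (fun k => ((Function.update e j x k : SignType) : ℝ)) =
        Function.update (fun k => ((e k : SignType) : ℝ)) j (x : ℝ) := by
      funext k
      by_cases hk : k = j
      · subst hk; simp
      · simp [hk]
    rw [this]
    simp only [h]

/-! ### Tangent cones -/

/-- A local arrangement `α` is a cylinder in the direction of the coordinate `i`. -/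
def IndependentOf {d : ℕ} (α : Set (Fin d → ℝ)) (i : Fin d) : Prop :=
  ∀ x t, Function.update x i t ∈ α ↔ x ∈ α

lemma mem_orthant_congr {d : ℕ} (s : Fin d → ℤˣ) {x y : Fin d → ℝ}
    (h : ∀ i, SignType.sign (x i) = SignType.sign (y i)) (hx : x ∈ orthant s) : y ∈ orthant s := by
  intro i
  have hi := h i
  have hxi := hx i
  rcases Int.units_eq_one_or (s i) with hs | hs <;> simp only [hs, Units.val_one, Units.val_neg,
    Int.cast_one, Int.cast_neg, one_mul, neg_mul, Left.nonneg_neg_iff] at hxi ⊢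
  · rwa [← sign_nonneg_iff, ← hi, sign_nonneg_iff]
  · rwa [← sign_nonpos_iff, ← hi, sign_nonpos_iff]

/-- Membership in a union of orthants depends only on the signs of the coordinates. -/
lemma IsLocalArrangement.mem_congr {d : ℕ} {α : Set (Fin d → ℝ)} (hα : IsLocalArrangement α)
    {x y : Fin d → ℝ} (h : ∀ i, SignType.sign (x i) = SignType.sign (y i)) : x ∈ α ↔ y ∈ α := by
  obtain ⟨S, rfl⟩ := hα
  simp only [Set.mem_iUnion]
  constructor
  · rintro ⟨s, hs, hx⟩
    exact ⟨s, hs, mem_orthant_congr s h hx⟩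
  · rintro ⟨s, hs, hy⟩
    exact ⟨s, hs, mem_orthant_congr s (fun i => (h i).symm) hy⟩

lemma IsLocalArrangement.smul_mem_iff {d : ℕ} {α : Set (Fin d → ℝ)} (hα : IsLocalArrangement α)
    (x : Fin d → ℝ) {r : ℝ} (hr : 0 < r) : (fun i => r * x i) ∈ α ↔ x ∈ α :=
  hα.mem_congr fun i => by rw [sign_mul, sign_pos hr, one_mul]

/-- A vector and a number can be shrunk simultaneously into any neighbourhood of the origin. -/
lemma exists_pos_abs_mul_lt {d : ℕ} (x : Fin d → ℝ) (t : ℝ) {δ : ℝ} (hδ : 0 < δ) :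
    ∃ r : ℝ, 0 < r ∧ (∀ i, |r * x i| < δ) ∧ |r * t| < δ := by
  have hsum : 0 ≤ ∑ i, |x i| := Finset.sum_nonneg fun _ _ => abs_nonneg _
  have ht := abs_nonneg t
  have hM : 0 < ∑ i, |x i| + |t| + 1 := by positivity
  have key : ∀ y : ℝ, |y| ≤ ∑ i, |x i| + |t| → |δ / (∑ i, |x i| + |t| + 1) * y| < δ := by
    intro y hy
    rw [abs_mul, abs_of_pos (by positivity), div_mul_eq_mul_div, div_lt_iff₀ hM]
    nlinarith
  refine ⟨δ / (∑ i, |x i| + |t| + 1), by positivity, fun i => key _ ?_, key _ (by linarith)⟩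
  have : |x i| ≤ ∑ i, |x i| := Finset.single_le_sum (f := fun i => |x i|)
    (fun _ _ => abs_nonneg _) (Finset.mem_univ i)
  linarith

lemma IsTangentCone.unique {d : ℕ} {P : Set (Fin d → ℝ)} {v : Fin d → ℝ} {α β : Set (Fin d → ℝ)}
    (hα : IsTangentCone P v α) (hβ : IsTangentCone P v β) : α = β := by
  obtain ⟨hα, δ, hδ, h⟩ := hα
  obtain ⟨hβ, ε, hε, h'⟩ := hβ
  ext x
  obtain ⟨r, hr, hx, _⟩ := exists_pos_abs_mul_lt x 0 (lt_min hδ hε)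
  rw [← hα.smul_mem_iff x hr, ← hβ.smul_mem_iff x hr,
    ← h _ fun i => ((hx i).trans_le (min_le_left _ _)).le,
    ← h' _ fun i => ((hx i).trans_le (min_le_right _ _)).le]

/-- Around a given point, the sides of finitely many boxes are either incident to the point or stay
away from it. -/
lemma exists_pos_lt_abs_sub {d : ℕ} (𝓑 : Finset (AxisBox d)) (v : Fin d → ℝ) :
    ∃ ε : ℝ, 0 < ε ∧ ∀ B ∈ 𝓑, ∀ i, (B.lo i ≠ v i → ε < |B.lo i - v i|) ∧
      (B.hi i ≠ v i → ε < |B.hi i - v i|) := by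
  have key : ∀ᶠ ε : ℝ in nhdsWithin 0 (Set.Ioi 0), ∀ B ∈ 𝓑, ∀ i,
      (B.lo i ≠ v i → ε < |B.lo i - v i|) ∧ (B.hi i ≠ v i → ε < |B.hi i - v i|) := by
    rw [Filter.eventually_all_finset]
    intro B _
    rw [Filter.eventually_all]
    intro i
    have aux : ∀ c : ℝ, ∀ᶠ ε : ℝ in nhdsWithin 0 (Set.Ioi 0), c ≠ v i → ε < |c - v i| := by
      intro c
      by_cases hc : c = v i
      · simp [hc]
      · have : 0 < |c - v i| := abs_pos.mpr (sub_ne_zero.mpr hc)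
        filter_upwards [nhdsWithin_le_nhds (Iio_mem_nhds this)] with ε hε _ using hε
    exact (aux _).and (aux _)
  obtain ⟨ε, h, hε⟩ := (key.and self_mem_nhdsWithin).exists
  exact ⟨ε, hε, h⟩

/-- Boxes that do not contain `v` stay away from it. -/
lemma AxisBox.mem_carrier_of_add_mem {d : ℕ} {B : AxisBox d} {v x : Fin d → ℝ} {ε : ℝ}
    (hB : ∀ i, (B.lo i ≠ v i → ε < |B.lo i - v i|) ∧ (B.hi i ≠ v i → ε < |B.hi i - v i|))
    (hx : ∀ i, |x i| ≤ ε) (h : v + x ∈ B.carrier) : v ∈ B.carrier := by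
  intro i
  have h₁ := h i
  have h₂ := hB i
  have h₃ := abs_le.mp (hx i)
  simp only [Pi.add_apply] at h₁
  constructor
  · by_contra! hlt
    have := h₂.1 hlt.ne'
    rw [abs_of_pos (by linarith)] at this
    linarith
  · by_contra! hlt
    have := h₂.2 hlt.ne
    rw [abs_of_neg (by linarith)] at this
    linarith

/-- A pure polytope has a tangent cone at each point: a box through the point looks locally like the
union of those orthants that point inwards in the sides incident to the point. -/
lemma IsPureOrthogonalPolytope.exists_isTangentCone {d : ℕ} {P : Set (Fin d → ℝ)}
    (hP : IsPureOrthogonalPolytope P) (v : Fin d → ℝ) : ∃ α, IsTangentCone P v α := by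
  obtain ⟨𝓑, hpure, rfl⟩ := hP
  obtain ⟨ε, hε, hloc⟩ := exists_pos_lt_abs_sub 𝓑 v
  refine ⟨_, ⟨{s | ∃ B ∈ 𝓑, v ∈ B.carrier ∧
    ∀ i, (B.lo i = v i → s i = 1) ∧ (B.hi i = v i → s i = -1)}, rfl⟩, ε, hε, fun x hx => ?_⟩
  simp only [Set.mem_iUnion, exists_prop]
  constructor
  · rintro ⟨B, hB, hxB⟩
    have hv : v ∈ B.carrier := AxisBox.mem_carrier_of_add_mem (hloc B hB) hx hxB
    refine ⟨fun i => if B.lo i = v i then 1 else if B.hi i = v i then -1 else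
      if 0 ≤ x i then 1 else -1, ⟨B, hB, hv, fun i => ?_⟩, fun i => ?_⟩
    · refine ⟨fun h => by simp [h], fun h => ?_⟩
      have := hpure B hB i
      have hne : B.lo i ≠ v i := by linarith
      simp [h, hne]
    · have h₁ := hxB i
      simp only [Pi.add_apply] at h₁
      dsimp only
      split_ifs with h₂ h₃ h₄
      · simp only [Units.val_one, Int.cast_one, one_mul]
        linarith
      · simp only [Units.val_neg, Units.val_one, Int.cast_neg, Int.cast_one, neg_mul, one_mul]
        linarith
      · simpa using h₄
      · simp only [Units.val_neg, Units.val_one, Int.cast_neg, Int.cast_one, neg_mul, one_mul]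
        linarith
  · rintro ⟨s, ⟨B, hB, hv, hs⟩, hxs⟩
    refine ⟨B, hB, fun i => ?_⟩
    have h₁ := hv i
    have h₂ := hloc B hB i
    have h₃ := abs_le.mp (hx i)
    have h₄ := hxs i
    simp only [Pi.add_apply]
    constructor
    · by_cases h : B.lo i = v i
      · rw [(hs i).1 h] at h₄
        simp only [Units.val_one, Int.cast_one, one_mul] at h₄
        linarith
      · have := h₂.1 h
        rw [abs_of_nonpos (by linarith)] at this
        linarith
    · by_cases h : B.hi i = v i
      · rw [(hs i).2 h] at h₄
        simp only [Units.val_neg, Units.val_one, Int.cast_neg, Int.cast_one, neg_mul,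
          one_mul] at h₄
        linarith
      · have := h₂.2 h
        rw [abs_of_nonneg (by linarith)] at this
        linarith

/-- The tangent cone at a point close to `v` is a cylinder in the direction of each coordinate in
which the point differs from `v`. -/
lemma IsTangentCone.independentOf_of_near {d : ℕ} {P : Set (Fin d → ℝ)} {v : Fin d → ℝ}
    {α : Set (Fin d → ℝ)} (hα : IsTangentCone P v α) :
    ∃ δ : ℝ, 0 < δ ∧ ∀ (x : Fin d → ℝ) (β : Set (Fin d → ℝ)) (i : Fin d), (∀ j, |x j| < δ) →
      x i ≠ 0 → IsTangentCone P (v + x) β → IndependentOf β i := by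
  obtain ⟨hα, δ, hδ, h⟩ := hα
  refine ⟨δ / 2, by positivity, fun x β i hx hxi ⟨hβ, ε, hε, h'⟩ y t => ?_⟩
  have hm : 0 < min (min ε (δ / 2)) |x i| :=
    lt_min (lt_min hε (by positivity)) (abs_pos.mpr hxi)
  obtain ⟨r, hr, hy, ht⟩ := exists_pos_abs_mul_lt y t hm
  -- after shrinking, membership in `β` can be read off from `α`
  have hread : ∀ z : Fin d → ℝ, (∀ j, |r * z j| < min (min ε (δ / 2)) |x i|) →
      (z ∈ β ↔ (x + fun j => r * z j) ∈ α) := by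
    intro z hz
    rw [← hβ.smul_mem_iff z hr, ← h', add_assoc, h]
    · intro j
      have h₁ := (hz j).trans_le ((min_le_left _ _).trans (min_le_right _ _))
      have h₂ := hx j
      exact (abs_add_le _ _).trans (by linarith)
    · exact fun j => ((hz j).trans_le ((min_le_left _ _).trans (min_le_left _ _))).le
  -- and the sign of the coordinate `i` is that of `x i`
  have hsign : ∀ z : ℝ, |r * z| < |x i| →
      SignType.sign (x i + r * z) = SignType.sign (x i) := by
    intro z hz
    have := abs_lt.mp hz
    rcases lt_or_gt_of_ne hxi with hneg | hpos
    · rw [abs_of_neg hneg] at this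
      rw [sign_neg hneg, sign_neg (by linarith)]
    · rw [abs_of_pos hpos] at this
      rw [sign_pos hpos, sign_pos (by linarith)]
  rw [hread y hy, hread]
  · apply hα.mem_congr
    intro j
    by_cases hj : j = i
    · subst hj
      simp only [Pi.add_apply, Function.update_self]
      rw [hsign _ (ht.trans_le (min_le_right _ _)), hsign _ ((hy j).trans_le (min_le_right _ _))]
    · simp [hj]
  · intro j
    by_cases hj : j = i
    · subst hj
      simpa using ht
    · simpa [hj] using hy j

lemma Congruent.exists_independentOf {d : ℕ} {α β : Set (Fin d → ℝ)} (h : Congruent α β)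
    {i : Fin d} (hβ : IndependentOf β i) : ∃ j, IndependentOf α j := by
  obtain ⟨f, s, rfl⟩ := h
  have hinj : Function.Injective
      (fun (x : Fin d → ℝ) (i : Fin d) => ((s i : ℤ) : ℝ) * x (f i)) := by
    intro x y hxy
    funext k
    have := congrFun hxy (f.symm k)
    simpa using this
  refine ⟨f i, fun x t => ?_⟩
  have hx := hβ (fun j => ((s j : ℤ) : ℝ) * x (f j)) (((s i : ℤ) : ℝ) * t)
  rw [hinj.mem_set_image (a := x)] at hx
  rw [← hx, ← hinj.mem_set_image (a := Function.update x (f i) t)]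
  have : (fun j => ((s j : ℤ) : ℝ) * Function.update x (f i) t (f j)) =
      Function.update (fun j => ((s j : ℤ) : ℝ) * x (f j)) i (((s i : ℤ) : ℝ) * t) := by
    funext j
    by_cases hj : j = i
    · subst hj; simp
    · simp [hj]
  rw [this]

/-! ### Vertices -/

lemma genericityDegree_eq_zero_iff {d : ℕ} (P : Set (Fin d → ℝ)) (v : Fin d → ℝ) :
    genericityDegree P v = 0 ↔ ∃ c, genericityRegion P v ⊆ {c} := by
  rw [genericityDegree, Nat.sInf_eq_zero]
  constructor
  · rintro (⟨I, c, hI, hcard⟩ | hempty)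
    · have : I = Finset.univ := by
        rw [← Finset.card_eq_iff_eq_univ, Fintype.card_fin]
        have := Finset.card_le_univ I
        rw [Fintype.card_fin] at this
        omega
      subst this
      exact ⟨c, fun x hx => funext fun i => hI hx i (Finset.mem_univ i)⟩
    · have hd : d ∈ {k | ∃ (I : Finset (Fin d)) (c : Fin d → ℝ),
          genericityRegion P v ⊆ generalizedHyperplane I c ∧ d - I.card = k} :=
        ⟨∅, 0, fun _ _ i hi => absurd hi (Finset.notMem_empty i), by simp⟩
      rw [hempty] at hd
      exact hd.elim
  · rintro ⟨c, hc⟩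
    refine Or.inl ⟨Finset.univ, c, fun x hx i _ => ?_, by simp⟩
    rw [hc hx]

lemma congruent_refl {d : ℕ} (α : Set (Fin d → ℝ)) : Congruent α α :=
  ⟨Equiv.refl _, fun _ => 1, by simp⟩

lemma IsTangentCone.mem_genericityRegion_self {d : ℕ} {P : Set (Fin d → ℝ)} {v : Fin d → ℝ}
    {α : Set (Fin d → ℝ)} (hα : IsTangentCone P v α) (hv : v ∈ P) : v ∈ genericityRegion P v :=
  ⟨Path.refl v, α, hα, fun _ => ⟨hv, α, hα, congruent_refl α⟩⟩

/-- Moving in the direction of a cylinder does not change the tangent cone. -/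
lemma IsTangentCone.notMem_vertices {d : ℕ} {P : Set (Fin d → ℝ)} {v : Fin d → ℝ}
    {α : Set (Fin d → ℝ)} (hα : IsTangentCone P v α) {i : Fin d} (hi : IndependentOf α i) :
    v ∉ vertices P := by
  rintro ⟨hv, hdeg⟩
  obtain ⟨c, hc⟩ := (genericityDegree_eq_zero_iff P v).mp hdeg
  have hvc : v = c := hc (hα.mem_genericityRegion_self hv)
  have hα' := hα
  obtain ⟨hloc, δ, hδ, h⟩ := hα'
  have hmove : ∀ (t : ℝ) (x : Fin d → ℝ), x + Pi.single i t ∈ α ↔ x ∈ α := by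
    intro t x
    rw [← hi x (x i + t)]
    congr! 1
    funext j
    by_cases hj : j = i
    · subst hj; simp
    · simp [hj]
  -- the segment from `v` to `v + δ / 2 • e i`
  let γ : Path v (v + Pi.single i (δ / 2)) :=
    { toFun := fun t => v + Pi.single i ((t : ℝ) * (δ / 2))
      continuous_toFun := by
        refine continuous_const.add ?_
        exact (continuous_single i).comp (by fun_prop)
      source' := by simp
      target' := by simp }
  have hcone : ∀ t : unitInterval, IsTangentCone P (γ t) α := by
    intro t
    refine ⟨hloc, δ / 2, by positivity, fun x hx => ?_⟩
    have ht₀ := t.2.1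
    have ht₁ := t.2.2
    change v + Pi.single i ((t : ℝ) * (δ / 2)) + x ∈ P ↔ _
    rw [add_assoc, add_comm (Pi.single i _) x, h, hmove]
    intro j
    refine (abs_add_le _ _).trans ?_
    have hs : |(Pi.single i ((t : ℝ) * (δ / 2)) : Fin d → ℝ) j| ≤ δ / 2 := by
      by_cases hj : j = i
      · subst hj
        rw [Pi.single_eq_same, abs_of_nonneg (by positivity)]
        nlinarith
      · rw [Pi.single_eq_of_ne hj, abs_zero]
        positivity
    linarith [hx j]
  have hmem : ∀ t : unitInterval, γ t ∈ P := by
    intro t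
    have h₀ : (0 : Fin d → ℝ) ∈ α := by
      rw [← h 0 (fun j => by simpa using hδ.le), add_zero]
      exact hv
    obtain ⟨_, ε, hε, h'⟩ := hcone t
    simpa using (h' 0 (fun j => by simpa using hε.le)).mpr h₀
  have hend : v + Pi.single i (δ / 2) = c :=
    hc ⟨γ, α, hα, fun t => ⟨hmem t, α, hcone t, congruent_refl α⟩⟩
  rw [← hvc] at hend
  have := congrFun hend i
  simp at this
  linarith

/-- At a point that is not a vertex the tangent cone is a cylinder: a path in the genericity region
that leaves the point passes through nearby points, at which the tangent cone is a cylinder. -/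
lemma IsTangentCone.exists_independentOf {d : ℕ} {P : Set (Fin d → ℝ)} {v : Fin d → ℝ}
    {α : Set (Fin d → ℝ)} (hα : IsTangentCone P v α) (hv : v ∈ P) (hvert : v ∉ vertices P) :
    ∃ i, IndependentOf α i := by
  obtain ⟨w, hw, hwv⟩ : ∃ w ∈ genericityRegion P v, w ≠ v := by
    by_contra! hcon
    exact hvert ⟨hv, (genericityDegree_eq_zero_iff P v).mpr ⟨v, hcon⟩⟩
  obtain ⟨γ, α', hα', hγ⟩ := hw
  obtain rfl := hα.unique hα'
  obtain ⟨δ, hδ, h⟩ := hα.independentOf_of_near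
  obtain ⟨t, htδ, htv⟩ : ∃ t, γ t ∈ Metric.ball v δ ∧ γ t ≠ v := by
    by_contra! hcon
    have hpre : γ ⁻¹' {v} = γ ⁻¹' Metric.ball v δ := by
      ext t
      refine ⟨fun ht => ?_, fun ht => hcon t ht⟩
      rw [Set.mem_preimage, Set.mem_singleton_iff] at ht
      rw [Set.mem_preimage, ht]
      exact Metric.mem_ball_self hδ
    have hclopen : IsClopen (γ ⁻¹' {v}) :=
      ⟨isClosed_singleton.preimage γ.continuous, hpre ▸ Metric.isOpen_ball.preimage γ.continuous⟩
    have huniv := hclopen.eq_univ ⟨0, by simp⟩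
    have : (1 : unitInterval) ∈ γ ⁻¹' {v} := huniv ▸ Set.mem_univ _
    exact hwv (by simpa using this)
  obtain ⟨i, hi⟩ := Function.ne_iff.mp htv
  obtain ⟨_, β, hβ, hcong⟩ := hγ t
  refine hcong.exists_independentOf (h (γ t - v) β i (fun j => ?_) (sub_ne_zero.mpr hi) ?_)
  · rw [Metric.mem_ball, dist_eq_norm] at htδ
    exact (norm_le_pi_norm (γ t - v) j).trans_lt htδ
  · simpa using hβ

/-! ### Cells of a box complex -/

/-- The relative interior of a box. -/
def AxisBox.relInterior {d : ℕ} (B : AxisBox d) : Set (Fin d → ℝ) :=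
  {x | ∀ i, (B.lo i = x i ∧ B.hi i = x i) ∨ (B.lo i < x i ∧ x i < B.hi i)}

/-- The corners of a box. -/
noncomputable def AxisBox.corners {d : ℕ} (B : AxisBox d) : Finset (Fin d → ℝ) :=
  Fintype.piFinset fun i => {B.lo i, B.hi i}

lemma AxisBox.mem_corners {d : ℕ} {B : AxisBox d} {v : Fin d → ℝ} :
    v ∈ B.corners ↔ ∀ i, v i = B.lo i ∨ v i = B.hi i := by
  simp [AxisBox.corners]

lemma AxisBox.dim_eq_sum {d : ℕ} (B : AxisBox d) :
    B.dim = ∑ i, if B.lo i < B.hi i then 1 else 0 := by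
  rw [AxisBox.dim, Set.ncard_eq_toFinset_card', Finset.sum_boole, Set.toFinset_ofPred, Nat.cast_id]

lemma AxisBox.card_corners {d : ℕ} (B : AxisBox d) : B.corners.card = 2 ^ B.dim := by
  rw [AxisBox.corners, Fintype.card_piFinset, B.dim_eq_sum, ← Finset.prod_pow_eq_pow_sum]
  refine Finset.prod_congr rfl fun i _ => ?_
  split_ifs with h
  · rw [Finset.card_pair h.ne, pow_one]
  · rw [le_antisymm (B.le i) (not_lt.mp h)]
    simp

lemma AxisBox.relInterior_subset {d : ℕ} (B : AxisBox d) : B.relInterior ⊆ B.carrier := by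
  intro x hx i
  rcases hx i with ⟨h₁, h₂⟩ | ⟨h₁, h₂⟩
  · exact ⟨h₁.le, h₂.ge⟩
  · exact ⟨h₁.le, h₂.le⟩

/-- The degenerate box that consists of a single point. -/
def AxisBox.single {d : ℕ} (v : Fin d → ℝ) : AxisBox d := ⟨v, v, fun _ => le_rfl⟩

lemma AxisBox.isFace_single {d : ℕ} {B : AxisBox d} {v : Fin d → ℝ} (hv : v ∈ B.corners) :
    (AxisBox.single v).IsFace B := by
  intro i
  rcases AxisBox.mem_corners.mp hv i with h | h
  · exact Or.inr (Or.inl ⟨h, h⟩)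
  · exact Or.inr (Or.inr ⟨h, h⟩)

/-- A face that contains a relatively interior point is the whole box. -/
lemma AxisBox.IsFace.eq_of_mem_relInterior {d : ℕ} {F B : AxisBox d} (h : F.IsFace B)
    {x : Fin d → ℝ} (hF : x ∈ F.carrier) (hB : x ∈ B.relInterior) : F = B := by
  have key : ∀ i, F.lo i = B.lo i ∧ F.hi i = B.hi i := by
    intro i
    have h₁ := hF i
    rcases h i with ⟨a, b⟩ | ⟨a, b⟩ | ⟨a, b⟩ <;> rcases hB i with ⟨u, w⟩ | ⟨u, w⟩ <;>
      constructor <;> linarith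
  exact AxisBox.ext (funext fun i => (key i).1) (funext fun i => (key i).2)

/-- Each point of a box lies in the relative interior of some face. -/
lemma AxisBox.exists_isFace_mem_relInterior {d : ℕ} {B : AxisBox d} {x : Fin d → ℝ}
    (hx : x ∈ B.carrier) : ∃ F : AxisBox d, F.IsFace B ∧ x ∈ F.relInterior := by
  refine ⟨⟨fun i => if B.lo i < x i ∧ x i < B.hi i then B.lo i else x i,
    fun i => if B.lo i < x i ∧ x i < B.hi i then B.hi i else x i, fun i => ?_⟩,
    fun i => ?_, fun i => ?_⟩
  · split_ifs
    · exact B.le i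
    · exact le_rfl
  · dsimp only
    split_ifs with h
    · exact Or.inl ⟨rfl, rfl⟩
    · rcases (hx i).1.lt_or_eq with h₁ | h₁
      · rcases (hx i).2.lt_or_eq with h₂ | h₂
        · exact absurd ⟨h₁, h₂⟩ h
        · exact Or.inr (Or.inr ⟨h₂, h₂⟩)
      · exact Or.inr (Or.inl ⟨h₁.symm, h₁.symm⟩)
  · dsimp only
    split_ifs with h
    · exact Or.inr h
    · exact Or.inl ⟨rfl, rfl⟩

lemma BoxComplex.mem_support {d : ℕ} {K : BoxComplex d} {x : Fin d → ℝ} :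
    x ∈ K.support ↔ ∃ B ∈ K.cells, x ∈ B.carrier := by
  simp [BoxComplex.support]

lemma BoxComplex.exists_mem_relInterior {d : ℕ} (K : BoxComplex d) {x : Fin d → ℝ}
    (hx : x ∈ K.support) : ∃ B ∈ K.cells, x ∈ B.relInterior := by
  obtain ⟨B, hB, hxB⟩ := BoxComplex.mem_support.mp hx
  obtain ⟨F, hF, hxF⟩ := AxisBox.exists_isFace_mem_relInterior hxB
  exact ⟨F, K.face_mem B hB F hF, hxF⟩

/-- A cell with a given relatively interior point is a face of each cell through that point. -/
lemma BoxComplex.isFace_of_mem_relInterior {d : ℕ} (K : BoxComplex d) {B C : AxisBox d}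
    (hB : B ∈ K.cells) (hC : C ∈ K.cells) {x : Fin d → ℝ} (hxB : x ∈ B.relInterior)
    (hxC : x ∈ C.carrier) : B.IsFace C := by
  have hx : x ∈ B.carrier ∩ C.carrier := ⟨B.relInterior_subset hxB, hxC⟩
  obtain ⟨F, hFB, hFC, hF⟩ := K.inter_face B hB C hC ⟨x, hx⟩
  rw [← hF] at hx
  exact hFB.eq_of_mem_relInterior hx hxB ▸ hFC

lemma BoxComplex.eq_of_mem_relInterior {d : ℕ} (K : BoxComplex d) {B C : AxisBox d}
    (hB : B ∈ K.cells) (hC : C ∈ K.cells) {x : Fin d → ℝ} (hxB : x ∈ B.relInterior)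
    (hxC : x ∈ C.relInterior) : B = C :=
  (K.isFace_of_mem_relInterior hB hC hxB (C.relInterior_subset hxC)).eq_of_mem_relInterior
    (B.relInterior_subset hxB) hxC

/-- The vertices of a box complex, that is, the corners of its cells. -/
noncomputable def BoxComplex.corners {d : ℕ} (K : BoxComplex d) : Finset (Fin d → ℝ) :=
  K.cells.biUnion AxisBox.corners

/-- If a corner of a complex lies in a cell, it is a corner of that cell. -/
lemma BoxComplex.mem_corners_of_mem_carrier {d : ℕ} (K : BoxComplex d) {v : Fin d → ℝ}
    (hv : v ∈ K.corners) {B : AxisBox d} (hB : B ∈ K.cells) (hvB : v ∈ B.carrier) :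
    v ∈ B.corners := by
  obtain ⟨C, hC, hvC⟩ := Finset.mem_biUnion.mp hv
  have hface := K.isFace_of_mem_relInterior
    (K.face_mem C hC _ (AxisBox.isFace_single hvC)) hB (x := v) (fun i => Or.inl ⟨rfl, rfl⟩) hvB
  rw [AxisBox.mem_corners]
  intro i
  rcases hface i with ⟨a, _⟩ | ⟨a, _⟩ | ⟨a, _⟩
  · exact Or.inl a
  · exact Or.inl a
  · exact Or.inr a

/-- The sign vector of a box as seen from one of its corners. -/
noncomputable def AxisBox.signVector {d : ℕ} (B : AxisBox d) (v : Fin d → ℝ) : Fin d → SignType :=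
  fun i => if B.lo i = B.hi i then 0 else if v i = B.lo i then 1 else -1

/-- The product of the face weights of the sign vector of a cell is its contribution to the corner
weight. -/
lemma AxisBox.prod_faceWeight_signVector {d : ℕ} (B : AxisBox d) (v : Fin d → ℝ) :
    (∏ i, faceWeight (B.signVector v i)) * 2 ^ B.dim = (-1) ^ B.dim * 2 ^ d := by
  have h₁ : ∀ z : ℤ, z ^ B.dim = ∏ i, z ^ (if B.lo i < B.hi i then 1 else 0) := by
    intro z
    rw [B.dim_eq_sum, Finset.prod_pow_eq_pow_sum]
  have h₂ : (2 : ℤ) ^ d = ∏ _i : Fin d, 2 := by simp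
  rw [h₁, h₁, h₂, ← Finset.prod_mul_distrib, ← Finset.prod_mul_distrib]
  refine Finset.prod_congr rfl fun i _ => ?_
  rcases (B.le i).lt_or_eq with h | h
  · have : faceWeight (B.signVector v i) = -1 := by
      simp only [AxisBox.signVector, if_neg h.ne]
      split_ifs <;> rfl
    simp [h, this]
  · have : faceWeight (B.signVector v i) = 2 := by
      simp only [AxisBox.signVector, if_pos h]
      rfl
    simp [h, this]

/-- The cells at a corner of a complex correspond to the faces of the tangent cone, through the sign
vectors. -/
lemma BoxComplex.sum_faceWeight_eq_cornerWeight {d : ℕ} (K : BoxComplex d) {v : Fin d → ℝ}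
    (hv : v ∈ K.corners) {α : Set (Fin d → ℝ)} (hα : IsTangentCone K.support v α) :
    ∑ B ∈ K.cells with v ∈ B.corners, ∏ i, faceWeight (B.signVector v i) = cornerWeight α := by
  classical
  obtain ⟨hloc, δ, hδ, h⟩ := hα
  obtain ⟨ε₀, hε₀, hnear₀⟩ := exists_pos_lt_abs_sub K.cells v
  obtain ⟨ε, hε, hεδ, hε₀'⟩ : ∃ ε, 0 < ε ∧ ε ≤ δ ∧ ε ≤ ε₀ :=
    ⟨min δ ε₀, lt_min hδ hε₀, min_le_left _ _, min_le_right _ _⟩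
  have hnear : ∀ B ∈ K.cells, ∀ i, (B.lo i ≠ v i → ε < |B.lo i - v i|) ∧
      (B.hi i ≠ v i → ε < |B.hi i - v i|) := fun B hB i =>
    ⟨fun hi => hε₀'.trans_lt ((hnear₀ B hB i).1 hi),
      fun hi => hε₀'.trans_lt ((hnear₀ B hB i).2 hi)⟩
  -- the point at distance `ε` from `v` in the direction of the sign vector `e`
  let q : (Fin d → SignType) → Fin d → ℝ := fun e => v + fun i => ε * (e i : ℝ)
  have hq : ∀ e : Fin d → SignType, q e ∈ K.support ↔ (fun i => ((e i : SignType) : ℝ)) ∈ α := by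
    intro e
    rw [h _ fun i => ?_, hloc.smul_mem_iff _ hε]
    rcases e i with _ | _ | _ <;> simp [abs_of_pos hε, hεδ, hδ.le]
  have hcell : ∀ B ∈ K.cells, v ∈ B.corners → q (B.signVector v) ∈ B.relInterior := by
    intro B hB hvB i
    have hn := hnear B hB i
    by_cases heq : B.lo i = B.hi i
    · left
      rcases AxisBox.mem_corners.mp hvB i with h | h <;>
        simp [q, AxisBox.signVector, heq, h]
    · right
      have hlt : B.lo i < B.hi i := lt_of_le_of_ne (B.le i) heq
      rcases AxisBox.mem_corners.mp hvB i with h | h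
      · have hn₂ := hn.2 (by rw [h]; exact hlt.ne')
        rw [h, abs_of_pos (by linarith)] at hn₂
        simp only [q, AxisBox.signVector, heq, if_false, Pi.add_apply, h, if_true, SignType.coe_one]
        constructor <;> linarith
      · have hn₂ := hn.1 (by rw [h]; exact hlt.ne)
        rw [h, abs_of_neg (by linarith)] at hn₂
        have hne : B.hi i ≠ B.lo i := hlt.ne'
        simp only [q, AxisBox.signVector, heq, if_false, Pi.add_apply, h, hne, SignType.coe_neg_one]
        constructor <;> linarith
  rw [cornerWeight, weightedSum]
  simp only [mul_ite, mul_one, mul_zero]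
  rw [← Finset.sum_filter]
  refine Finset.sum_bij (fun B _ => B.signVector v) ?_ ?_ ?_ (fun _ _ => rfl)
  · intro B hB
    rw [Finset.mem_filter] at hB
    rw [Finset.mem_filter, ← hq]
    exact ⟨Finset.mem_univ _, BoxComplex.mem_support.mpr
      ⟨B, hB.1, B.relInterior_subset (hcell B hB.1 hB.2)⟩⟩
  · intro B hB C hC hBC
    rw [Finset.mem_filter] at hB hC
    exact K.eq_of_mem_relInterior hB.1 hC.1 (hcell B hB.1 hB.2) (hBC ▸ hcell C hC.1 hC.2)
  · intro e he
    rw [Finset.mem_filter, ← hq] at he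
    obtain ⟨B, hB, hqB⟩ := K.exists_mem_relInterior he.2
    have habs : ∀ i, |ε * (e i : ℝ)| ≤ ε := by
      intro i
      rcases e i with _ | _ | _ <;> simp [abs_of_pos hε, hε.le]
    have hvB : v ∈ B.carrier := AxisBox.mem_carrier_of_add_mem (hnear B hB) habs
      (B.relInterior_subset hqB)
    have hvc := K.mem_corners_of_mem_carrier hv hB hvB
    refine ⟨B, Finset.mem_filter.mpr ⟨hB, hvc⟩, ?_⟩
    funext i
    have h₁ := hqB i
    have h₂ := AxisBox.mem_corners.mp hvc i
    have hle := B.le i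
    simp only [q, Pi.add_apply] at h₁
    have htri : e i = 0 ∨ e i = 1 ∨ e i = -1 := by
      rcases e i with _ | _ | _ <;> decide
    simp only [AxisBox.signVector]
    rcases htri with he | he | he <;> rw [he] at h₁ ⊢
    · rw [SignType.coe_zero, mul_zero, add_zero] at h₁
      rw [if_pos]
      rcases h₁ with h₁ | h₁
      · exact h₁.1.trans h₁.2.symm
      · rcases h₂ with h₂ | h₂ <;> linarith [h₁.1, h₁.2]
    · rw [SignType.coe_one, mul_one] at h₁
      rcases h₁ with h₁ | h₁
      · rcases h₂ with h₂ | h₂ <;> linarith [h₁.1, h₁.2]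
      · rw [if_neg (by linarith [h₁.1, h₁.2]), if_pos]
        rcases h₂ with h₂ | h₂
        · exact h₂
        · linarith [h₁.1, h₁.2]
    · rw [SignType.coe_neg_one] at h₁
      rcases h₁ with h₁ | h₁
      · rcases h₂ with h₂ | h₂ <;> linarith [h₁.1, h₁.2]
      · rw [if_neg (by linarith [h₁.1, h₁.2]), if_neg]
        intro h₃
        linarith [h₁.1, h₁.2]

/-- The Euler characteristic of a box complex, localized at its corners: the cell `B` has
`2 ^ B.dim` corners, and it contributes `(-1) ^ B.dim * 2 ^ (d - B.dim)` to each of them. -/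
theorem BoxComplex.two_pow_mul_eulerChar {d : ℕ} (K : BoxComplex d)
    (α : (Fin d → ℝ) → Set (Fin d → ℝ)) (hα : ∀ v, IsTangentCone K.support v (α v)) :
    2 ^ d * K.eulerChar = ∑ v ∈ K.corners, cornerWeight (α v) := by
  classical
  have h₁ : ∀ B ∈ K.cells, 2 ^ d * (-1 : ℤ) ^ B.dim =
      ∑ v ∈ K.corners, if v ∈ B.corners then ∏ i, faceWeight (B.signVector v i) else 0 := by
    intro B hB
    have hsub : B.corners ⊆ K.corners := Finset.subset_biUnion_of_mem _ hB
    rw [← Finset.sum_filter, Finset.filter_mem_eq_inter, Finset.inter_eq_right.mpr hsub]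
    have hpos : (2 : ℤ) ^ B.dim ≠ 0 := by positivity
    apply mul_right_cancel₀ hpos
    rw [Finset.sum_mul]
    simp only [B.prod_faceWeight_signVector]
    rw [Finset.sum_const, B.card_corners, nsmul_eq_mul]
    push_cast
    ring
  rw [BoxComplex.eulerChar, Finset.mul_sum, Finset.sum_congr rfl h₁, Finset.sum_comm]
  refine Finset.sum_congr rfl fun v hv => ?_
  rw [← Finset.sum_filter, K.sum_faceWeight_eq_cornerWeight hv (hα v)]

/-- The vertices of the support of a complex are corners of the complex: a point in the relative
interior of a cell of positive dimension can be moved inside that cell. -/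
lemma BoxComplex.vertices_subset_corners {d : ℕ} (K : BoxComplex d) {v : Fin d → ℝ}
    {α : Set (Fin d → ℝ)} (hα : IsTangentCone K.support v α) (hv : v ∈ vertices K.support) :
    v ∈ K.corners := by
  by_contra hvK
  obtain ⟨B, hB, hvB⟩ := K.exists_mem_relInterior hv.1
  obtain ⟨i, hi⟩ : ∃ i, B.lo i < v i ∧ v i < B.hi i := by
    by_contra! hcon
    refine hvK (Finset.mem_biUnion.mpr ⟨B, hB, AxisBox.mem_corners.mpr fun i => ?_⟩)
    rcases hvB i with h | h
    · exact Or.inl h.1.symm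
    · exact absurd h.2 (not_lt.mpr (hcon i h.1))
  refine hα.notMem_vertices (i := i) (fun x t => ?_) hv
  obtain ⟨hloc, δ, hδ, h⟩ := hα
  obtain ⟨ε, hε, hnear⟩ := exists_pos_lt_abs_sub K.cells v
  -- close to `v`, membership in the support does not depend on the coordinate `i`
  have hmem : ∀ y z : Fin d → ℝ, (∀ j, |y j| < ε) → (∀ j, |z j| < ε) → (∀ j, j ≠ i → y j = z j) →
      v + y ∈ K.support → v + z ∈ K.support := by
    intro y z hy hz hyz hmem
    obtain ⟨C, hC, hyC⟩ := BoxComplex.mem_support.mp hmem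
    have hvC : v ∈ C.carrier :=
      AxisBox.mem_carrier_of_add_mem (hnear C hC) (fun j => (hy j).le) hyC
    have hface := K.isFace_of_mem_relInterior hB hC hvB hvC
    refine BoxComplex.mem_support.mpr ⟨C, hC, fun j => ?_⟩
    by_cases hj : j = i
    · subst hj
      obtain ⟨hlo, hhi⟩ : B.lo j = C.lo j ∧ B.hi j = C.hi j := by
        rcases hface j with h | h | h
        · exact h
        · linarith [h.1, h.2, hi.1, hi.2]
        · linarith [h.1, h.2, hi.1, hi.2]
      rw [hlo, hhi] at hi
      have h₁ := (hnear C hC j).1 hi.1.ne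
      have h₂ := (hnear C hC j).2 hi.2.ne'
      have h₃ := abs_lt.mp (hz j)
      rw [abs_of_neg (by linarith [hi.1])] at h₁
      rw [abs_of_pos (by linarith [hi.2])] at h₂
      simp only [Pi.add_apply]
      constructor <;> linarith
    · have := hyC j
      rwa [Pi.add_apply, hyz j hj] at this
  have hm : 0 < min δ ε := lt_min hδ hε
  obtain ⟨r, hr, hx, ht⟩ := exists_pos_abs_mul_lt x t hm
  have hxt : ∀ j, |r * Function.update x i t j| < min δ ε := by
    intro j
    by_cases hj : j = i
    · subst hj
      simpa using ht
    · simpa [hj] using hx j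
  have heq : ∀ j, j ≠ i → r * Function.update x i t j = r * x j := by
    intro j hj
    rw [Function.update_of_ne hj]
  rw [← hloc.smul_mem_iff x hr, ← hloc.smul_mem_iff (Function.update x i t) hr,
    ← h _ fun j => ((hx j).trans_le (min_le_left _ _)).le,
    ← h _ fun j => ((hxt j).trans_le (min_le_left _ _)).le]
  have hx' := fun j => (hx j).trans_le (min_le_right _ _)
  have hxt' := fun j => (hxt j).trans_le (min_le_right _ _)
  exact ⟨hmem _ _ hxt' hx' heq, hmem _ _ hx' hxt' fun j hj => (heq j hj).symm⟩

/-! ### Subdivision of an orthogonal polytope -/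

/-- The elementary intervals of a finite set `C` of real numbers: the points of `C`, and the
intervals between consecutive points of `C`. -/
def IsElementaryInterval (C : Finset ℝ) (a b : ℝ) : Prop :=
  a ∈ C ∧ b ∈ C ∧ a ≤ b ∧ ∀ c ∈ C, c ≤ a ∨ b ≤ c

/-- The boxes with elementary sides that are contained in `P`. -/
def gridCells {d : ℕ} (C : Finset ℝ) (P : Set (Fin d → ℝ)) : Set (AxisBox d) :=
  {B | (∀ i, IsElementaryInterval C (B.lo i) (B.hi i)) ∧ B.carrier ⊆ P}

lemma finite_gridCells {d : ℕ} (C : Finset ℝ) (P : Set (Fin d → ℝ)) : (gridCells C P).Finite := by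
  have hfin : (Set.univ.pi fun _ : Fin d => (C : Set ℝ)).Finite :=
    Set.Finite.pi fun _ => C.finite_toSet
  refine Set.Finite.of_finite_image (f := fun B : AxisBox d => (B.lo, B.hi))
    ((hfin.prod hfin).subset ?_) ?_
  · rintro _ ⟨B, hB, rfl⟩
    exact ⟨fun i _ => (hB.1 i).1, fun i _ => (hB.1 i).2.1⟩
  · intro A _ B _ h
    rw [Prod.mk.injEq] at h
    exact AxisBox.ext h.1 h.2

/-- The complex of all boxes with elementary sides that are contained in `P`. -/
noncomputable def gridComplex {d : ℕ} (C : Finset ℝ) (P : Set (Fin d → ℝ)) : BoxComplex d where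
  cells := (finite_gridCells C P).toFinset
  face_mem := by
    intro B hB F hF
    rw [Set.Finite.mem_toFinset] at hB ⊢
    refine ⟨fun i => ?_, fun x hx => hB.2 fun i => ?_⟩
    · obtain ⟨h₁, h₂, h₃, h₄⟩ := hB.1 i
      rcases hF i with ⟨a, b⟩ | ⟨a, b⟩ | ⟨a, b⟩ <;> rw [a, b]
      · exact ⟨h₁, h₂, h₃, h₄⟩
      · exact ⟨h₁, h₁, le_rfl, fun c _ => le_total c _⟩
      · exact ⟨h₂, h₂, le_rfl, fun c _ => le_total c _⟩
    · have h₁ := hx i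
      have h₂ := B.le i
      rcases hF i with ⟨a, b⟩ | ⟨a, b⟩ | ⟨a, b⟩ <;> constructor <;> linarith
  inter_face := by
    intro A hA B hB hne
    rw [Set.Finite.mem_toFinset] at hA hB
    obtain ⟨x, hxA, hxB⟩ := hne
    refine ⟨⟨fun i => max (A.lo i) (B.lo i), fun i => min (A.hi i) (B.hi i), fun i => ?_⟩,
      fun i => ?_, fun i => ?_, ?_⟩
    · exact max_le (le_min (A.le i) ((hxA i).1.trans (hxB i).2))
        (le_min ((hxB i).1.trans (hxA i).2) (B.le i))
    · obtain ⟨a₁, a₂, a₃, a₄⟩ := hA.1 i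
      obtain ⟨b₁, b₂, b₃, b₄⟩ := hB.1 i
      have := hxA i
      have := hxB i
      have := a₄ _ b₁
      have := a₄ _ b₂
      have := b₄ _ a₁
      have := b₄ _ a₂
      dsimp only
      grind
    · obtain ⟨a₁, a₂, a₃, a₄⟩ := hA.1 i
      obtain ⟨b₁, b₂, b₃, b₄⟩ := hB.1 i
      have := hxA i
      have := hxB i
      have := a₄ _ b₁
      have := a₄ _ b₂
      have := b₄ _ a₁
      have := b₄ _ a₂
      dsimp only
      grind
    · ext y
      simp only [AxisBox.carrier, Set.mem_ofPred_eq, Set.mem_inter_iff, max_le_iff, le_min_iff]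
      exact ⟨fun h => ⟨fun i => ⟨(h i).1.1, (h i).2.1⟩, fun i => ⟨(h i).1.2, (h i).2.2⟩⟩,
        fun h i => ⟨⟨(h.1 i).1, (h.2 i).1⟩, ⟨(h.1 i).2, (h.2 i).2⟩⟩⟩

/-- A point between two points of `C` lies in an elementary interval between them. -/
lemma exists_isElementaryInterval {C : Finset ℝ} {a b x : ℝ} (ha : a ∈ C) (hb : b ∈ C)
    (hax : a ≤ x) (hxb : x ≤ b) :
    ∃ a' b', IsElementaryInterval C a' b' ∧ a ≤ a' ∧ b' ≤ b ∧ a' ≤ x ∧ x ≤ b' := by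
  obtain ⟨a', ha', hmax⟩ := (C.filter (· ≤ x)).exists_max_image id
    ⟨a, Finset.mem_filter.mpr ⟨ha, hax⟩⟩
  obtain ⟨b', hb', hmin⟩ := (C.filter (x ≤ ·)).exists_min_image id
    ⟨b, Finset.mem_filter.mpr ⟨hb, hxb⟩⟩
  rw [Finset.mem_filter] at ha' hb'
  refine ⟨a', b', ⟨ha'.1, hb'.1, ha'.2.trans hb'.2, fun c hc => ?_⟩,
    hmax a (Finset.mem_filter.mpr ⟨ha, hax⟩), hmin b (Finset.mem_filter.mpr ⟨hb, hxb⟩),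
    ha'.2, hb'.2⟩
  rcases le_total c x with h | h
  · exact Or.inl (hmax c (Finset.mem_filter.mpr ⟨hc, h⟩))
  · exact Or.inr (hmin c (Finset.mem_filter.mpr ⟨hc, h⟩))

lemma IsPureOrthogonalPolytope.exists_boxComplex {d : ℕ} {P : Set (Fin d → ℝ)}
    (hP : IsPureOrthogonalPolytope P) : ∃ K : BoxComplex d, K.support = P := by
  obtain ⟨𝓑, _, hPB⟩ := hP
  let C : Finset ℝ := 𝓑.biUnion fun B => Finset.univ.image B.lo ∪ Finset.univ.image B.hi
  refine ⟨gridComplex C P, Set.Subset.antisymm (fun x hx => ?_) fun x hx => ?_⟩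
  · obtain ⟨B, hB, hxB⟩ := BoxComplex.mem_support.mp hx
    exact ((finite_gridCells C P).mem_toFinset.mp hB).2 hxB
  · have hx' := hx
    rw [hPB] at hx'
    simp only [Set.mem_iUnion] at hx'
    obtain ⟨B, hB, hxB⟩ := hx'
    have hlo : ∀ i, B.lo i ∈ C := fun i => Finset.mem_biUnion.mpr ⟨B, hB, by simp⟩
    have hhi : ∀ i, B.hi i ∈ C := fun i => Finset.mem_biUnion.mpr ⟨B, hB, by simp⟩
    choose a b hel ha hb hax hxb using fun i =>
      exists_isElementaryInterval (hlo i) (hhi i) (hxB i).1 (hxB i).2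
    refine BoxComplex.mem_support.mpr ⟨⟨a, b, fun i => (hel i).2.2.1⟩,
      (finite_gridCells C P).mem_toFinset.mpr ⟨hel, fun y hy => ?_⟩, fun i => ⟨hax i, hxb i⟩⟩
    rw [hPB]
    simp only [Set.mem_iUnion]
    exact ⟨B, hB, fun i => ⟨(ha i).trans (hy i).1, (hy i).2.trans (hb i)⟩⟩

/-! ### Generic orthotopes -/

lemma IsFloralAt.cornerWeight_eq {d : ℕ} {P : Set (Fin d → ℝ)} {v : Fin d → ℝ}
    {Δ : SPD (Fin d)} {s : Fin d → ℤˣ} (h : IsFloralAt P v Δ s) {α : Set (Fin d → ℝ)}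
    (hα : IsTangentCone P v α) : cornerWeight α = Δ.bouquetSign := by
  rw [hα.unique h.2, cornerWeight_arrangement Δ s h.1]

lemma IsFloralAt.vertexSign_eq {d : ℕ} {P : Set (Fin d → ℝ)} {v : Fin d → ℝ}
    {Δ : SPD (Fin d)} {s : Fin d → ℤˣ} (h : IsFloralAt P v Δ s) :
    vertexSign P v = Δ.bouquetSign := by
  classical
  have hex : ∃ Δ : SPD (Fin d), ∃ s : Fin d → ℤˣ, IsFloralAt P v Δ s := ⟨Δ, s, h⟩
  obtain ⟨s', hs'⟩ := hex.choose_spec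
  rw [vertexSign, dif_pos hex, ← hs'.cornerWeight_eq h.2, h.cornerWeight_eq h.2]

/-- Only the vertices contribute to the localized Euler characteristic. -/
theorem IsGenericOrthotope.two_pow_mul_eulerChar {d : ℕ} {K : BoxComplex d}
    (hK : IsGenericOrthotope K.support) :
    (vertices K.support).Finite ∧ 2 ^ d * K.eulerChar = sigma K.support := by
  classical
  choose α hα using hK.1.exists_isTangentCone
  have hsub : ∀ v ∈ vertices K.support, v ∈ K.corners :=
    fun v hv => K.vertices_subset_corners (hα v) hv
  have hverts : vertices K.support = ↑(K.corners.filter (· ∈ vertices K.support)) := by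
    ext v
    simpa using hsub v
  refine ⟨K.corners.finite_toSet.subset hsub, ?_⟩
  rw [K.two_pow_mul_eulerChar α hα, sigma]
  conv_rhs => rw [hverts]
  rw [finsum_mem_coe_finset, Finset.sum_filter]
  refine Finset.sum_congr rfl fun v hv => ?_
  split_ifs with hvert
  · obtain ⟨Δ, s, hΔ⟩ := hK.2 v hvert
    rw [hΔ.cornerWeight_eq (hα v), hΔ.vertexSign_eq]
  · have hvP : v ∈ K.support := by
      obtain ⟨B, hB, hvB⟩ := Finset.mem_biUnion.mp hv
      refine BoxComplex.mem_support.mpr ⟨B, hB, fun i => ?_⟩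
      have := B.le i
      rcases AxisBox.mem_corners.mp hvB i with h | h <;> rw [h]
      · exact ⟨le_rfl, this⟩
      · exact ⟨this, le_rfl⟩
    obtain ⟨i, hi⟩ := (hα v).exists_independentOf hvP hvert
    exact cornerWeight_eq_zero _ i hi

/-! ### Counting octants -/

lemma IsLocalArrangement.orthant_subset_iff {d : ℕ} {α : Set (Fin d → ℝ)}
    (hα : IsLocalArrangement α) (s : Fin d → ℤˣ) :
    orthant s ⊆ α ↔ (fun i => ((s i : ℤ) : ℝ)) ∈ α := by
  constructor
  · intro h
    refine h fun i => ?_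
    exact mul_self_nonneg _
  · obtain ⟨S, rfl⟩ := hα
    intro h
    simp only [Set.mem_iUnion] at h
    obtain ⟨t, ht, hst⟩ := h
    -- the interior of the orthant `s` meets no other orthant
    have : t = s := by
      funext i
      have hi : 0 ≤ ((t i : ℤ) : ℝ) * ((s i : ℤ) : ℝ) := hst i
      rcases Int.units_eq_one_or (s i) with h₁ | h₁ <;>
        rcases Int.units_eq_one_or (t i) with h₂ | h₂ <;> rw [h₁, h₂] at hi ⊢ <;> norm_num at hi
    subst this
    exact Set.subset_biUnion_of_mem (u := orthant) ht

/-- The number of orthants of a floral vertex is its mass for the counting measure on orthants. -/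
lemma SPTree.ncard_orthants {d : ℕ} (Δ : SPTree (Fin d)) (s : Fin d → ℤˣ)
    (hΔ : Δ.edges = (Finset.univ : Finset (Fin d)).val)
    (hloc : IsLocalArrangement (Δ.arrangement s)) :
    (Set.ncard {t : Fin d → ℤˣ | orthant t ⊆ Δ.arrangement s} : ℤ) = Δ.mass 2 := by
  classical
  have huniv : (Finset.univ : Finset ℤˣ) = {1, -1} := rfl
  have hne : (1 : ℤˣ) ≠ -1 := by decide
  rw [← Δ.weightedSum_indicator (1 : ℤˣ) 2 (fun _ _ => 1)
    (fun i x => if 0 ≤ ((s i : ℤ) : ℝ) * ((x : ℤ) : ℝ) then 1 else 0) hΔ]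
  · rw [Set.ncard_eq_toFinset_card', weightedSum]
    simp only [Finset.prod_const_one, one_mul]
    simp only [SPTree.indicator_eq_ite (fun x : ℤˣ => ((x : ℤ) : ℝ)), hloc.orthant_subset_iff,
      Set.toFinset_ofPred, Finset.sum_boole]
  · intro i
    simp
  · intro i
    rw [huniv, Finset.sum_pair hne]
    rcases Int.units_eq_one_or (s i) with h | h <;> simp [h]

/-- In dimension `3` the number of octants of a floral vertex determines its bouquet sign. -/
lemma IsFloralAt.vertexSign_eq_of_octants {P : Set (Fin 3 → ℝ)} {v : Fin 3 → ℝ}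
    {Δ : SPD (Fin 3)} {s : Fin 3 → ℤˣ} (h : IsFloralAt P v Δ s) {α : Set (Fin 3 → ℝ)}
    (hα : IsTangentCone P v α) {n : ℕ} (hn : Set.ncard {t : Fin 3 → ℤˣ | orthant t ⊆ α} = n) :
    vertexSign P v = (if n = 1 then 1 else 0) - (if n = 3 then 1 else 0)
      - (if n = 5 then 1 else 0) + (if n = 7 then 1 else 0) := by
  obtain rfl := hα.unique h.2
  rw [h.vertexSign_eq]
  cases Δ with
  | point =>
    have := congrArg Multiset.card h.1
    simp [SPD.edges] at this
  | tree Δ =>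
    have hcard : Multiset.card Δ.edges = 3 := by
      have := congrArg Multiset.card h.1
      simpa [SPD.edges] using this
    have hmass := Δ.ncard_orthants s h.1 h.2.1
    rw [← SPTree.mass_zero]
    change Set.ncard {t : Fin 3 → ℤˣ | orthant t ⊆ Δ.arrangement s} = n at hn
    rw [hn] at hmass
    rcases Δ.mass_of_card_eq_three hcard with ⟨h₁, h₂⟩ | ⟨h₁, h₂⟩ | ⟨h₁, h₂⟩ | ⟨h₁, h₂⟩
    · obtain rfl : n = 1 := by omega
      simp [h₁]
    · obtain rfl : n = 3 := by omega
      simp [h₁]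
    · obtain rfl : n = 5 := by omega
      simp [h₁]
    · obtain rfl : n = 7 := by omega
      simp [h₁]

theorem IsGenericOrthotope.sigma_eq_vertexCount {P : Set (Fin 3 → ℝ)} (hP : IsGenericOrthotope P)
    (hfin : (vertices P).Finite) :
    sigma P = vertexCount P 1 - vertexCount P 3 - vertexCount P 5 + vertexCount P 7 := by
  classical
  choose α hα using hP.1.exists_isTangentCone
  have hcount : ∀ k, (vertexCount P k : ℤ) = ∑ v ∈ hfin.toFinset,
      if Set.ncard {t : Fin 3 → ℤˣ | orthant t ⊆ α v} = k then 1 else 0 := by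
    intro k
    rw [vertexCount, Finset.sum_boole, ← Set.ncard_coe_finset]
    congr 2
    ext v
    simp only [Set.mem_ofPred_eq, Finset.coe_filter, Set.Finite.mem_toFinset]
    refine and_congr_right fun _ => ⟨?_, fun h => ⟨α v, hα v, h⟩⟩
    rintro ⟨β, hβ, h⟩
    rwa [(hα v).unique hβ]
  rw [sigma, finsum_mem_eq_finite_toFinset_sum _ hfin, hcount, hcount, hcount, hcount,
    ← Finset.sum_sub_distrib, ← Finset.sum_sub_distrib, ← Finset.sum_add_distrib]
  refine Finset.sum_congr rfl fun v hv => ?_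
  obtain ⟨Δ, s, hΔ⟩ := hP.2 v (hfin.mem_toFinset.mp hv)
  exact hΔ.vertexSign_eq_of_octants (hα v) rfl

end Orthotope

theorem mainTheorem1 (d : ℕ) (P : Set (Fin d → ℝ)) (hP : Orthotope.IsGenericOrthotope P) :
    (Orthotope.vertices P).Finite ∧
    (∀ v ∈ Orthotope.vertices P, ∀ (Δ : Orthotope.SPD (Fin d)) (s : Fin d → ℤˣ),
      Orthotope.IsFloralAt P v Δ s → Δ.bouquetSign = Orthotope.vertexSign P v) ∧
    ∃ χ : ℤ, Orthotope.HasEulerChar P χ ∧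
      (χ : ℚ) = (2 : ℚ) ^ (-(d : ℤ)) * (Orthotope.sigma P : ℚ) ∧
      (d = 3 →
        (Orthotope.vertexCount P 1 : ℤ) - (Orthotope.vertexCount P 3 : ℤ)
          - (Orthotope.vertexCount P 5 : ℤ) + (Orthotope.vertexCount P 7 : ℤ) = 8 * χ) := by
  obtain ⟨K, rfl⟩ := hP.1.exists_boxComplex
  obtain ⟨hfin, hχ⟩ := hP.two_pow_mul_eulerChar
  refine ⟨hfin, fun v _ Δ s h => h.vertexSign_eq.symm, K.eulerChar, ⟨⟨K, rfl⟩, ?_⟩, ?_, ?_⟩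
  · intro L hL
    have hL' := (Orthotope.IsGenericOrthotope.two_pow_mul_eulerChar (K := L) (hL ▸ hP)).2
    rw [hL, ← hχ] at hL'
    exact mul_left_cancel₀ (by positivity) hL'
  · rw [← hχ, zpow_neg, zpow_natCast]
    push_cast
    rw [inv_mul_cancel_left₀ (by positivity)]
  · rintro rfl
    rw [← hP.sigma_eq_vertexCount hfin, ← hχ]
    norm_num
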